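/- **Setting.** A network is a finite directed multigraph (cycles and parallel links allowed) whose links have unit capacity: in each time slot $t=1,\dots,n$ every link carries one bit. In a communication problem, independent messages originate at given source nodes, and each is demanded at a given destination node. A length-$n$ code lets every node hold local randomness, independent of the messages and of the randomness of the other nodes. The bit sent on a link in slot $t$ is a function of the messages originating at its tail, of the tail's randomness, and of the bits received by the tail in earlier slots. After $n$ slots each destination decodes from everything it has. Message $i$ is uniform on a finite set $\mathcal S_n^{(i)}$. A rate tuple $(R_i)$ is feasible if there is a sequence of length-$n$ codes with $\frac1n\log_2|\mathcal S^{(i)}_n|\to R_i$ and decoding error probability of message $i$ tending to $0$ for every $i$. The $K$-unicast problem with source-destination pairs $(S_i,T_i)$, $i=1,\dots,K$, of unit rate on a network $\mathcal N$ is feasible if the rate tuple $(1,\dots,1)$ is feasible. For a single source with message $M$ and for $X^n(e)$ the signal on link $e$, a secrecy rate $R$ is feasible if $R$ is feasible with a sequence of codes that also satisfies, for every single link $e$: $I(M;X^n(e))=0$ for all $n$ (perfect secrecy), $I(M;X^n(e))\to0$ (strong secrecy), or $\frac1n I(M;X^n(e))\to0$ (weak secrecy). The secrecy capacity is the supremum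 of the feasible secrecy rates. **Construction.** Given a $K$-unicast problem on $\mathcal N$ with pairs $(S_i,T_i)$, embed $\mathcal N$ in the following network with one source $S$ and one destination $D$. Add new nodes $S$, $D$ and, for each $i=1,\dots,K$, nodes $A_i,B_i,C_i,F_i$. Keep all links of $\mathcal N$ and add for each $i$ the following unit-capacity links: two parallel links $S\to A_i$; links $B_i\to A_i$ and $B_i\to S_i$; a link $A_i\to C_i$; a link $T_i\to C_i$; links $F_i\to C_i$ and $F_i\to D$; and a link $C_i\to D$. Any single link of this network (including the links of $\mathcal N$) may be wiretapped. **Theorem 1.** For every $K$-unicast problem with unit-rate pairs $(S_i,T_i)$, $i=1,\dots,K$, and for each of the three secrecy requirements (perfect, strong, weak), the secrecy capacity from $S$ to $D$ of the network constructed above equals $K$ if and only if the $K$-unicast problem is feasible. -/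

import Mathlib

/-- A communication problem on a finite directed multigraph with vertices `V` and unit-capacity
links `E`; link `e` goes from `tail e` to `head e`. For every `i : ι` an independent message
originates at the vertex `src i` and is demanded by the vertex `dst i`. Cycles, parallel links and
coinciding sources or destinations are allowed. -/
structure CommProblem (V E ι : Type*) where
  tail : E → V
  head : E → V
  src : ι → V
  dst : ι → V

/-- A code of length (duration) `n`. Every vertex `v` holds local randomness (a key), drawn
according to `keyProb v` from a finite set; keys of different vertices and the messages are
independent, and the messages are uniform. In each of the time slots `t = 0, …, n - 1` every link
carries one bit, a function of the messages that originate at its tail, of the key of its tail, and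
of the bits that its tail received in the earlier time slots. After the `n` time slots, every
destination decodes from its incoming links (and from its own key and messages).

Local randomness with a finite range is fully general: all link alphabets are finite, so that a
vertex with arbitrary randomness just selects one of finitely many deterministic strategies. -/
structure Code {V E ι : Type*} (P : CommProblem V E ι) (n : ℕ) where
  msgCard : ι → ℕ
  msgCard_pos : ∀ i, 0 < msgCard i
  keyCard : V → ℕ
  keyProb : ∀ v, Fin (keyCard v) → ℝ
  keyProb_nonneg : ∀ v k, 0 ≤ keyProb v k
  keyProb_sum : ∀ v, ∑ k, keyProb v k = 1
  encode : ∀ (e : E) (t : Fin n),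
    (∀ i : {i : ι // P.src i = P.tail e}, Fin (msgCard i)) →
    Fin (keyCard (P.tail e)) →
    ({e' : E // P.head e' = P.tail e} → Fin (t : ℕ) → Bool) → Bool
  decode : ∀ i : ι,
    (∀ j : {j : ι // P.src j = P.dst i}, Fin (msgCard j)) →
    Fin (keyCard (P.dst i)) →
    ({e' : E // P.head e' = P.dst i} → Fin n → Bool) → Fin (msgCard i)

namespace Code

variable {V E ι : Type*} {P : CommProblem V E ι} {n : ℕ}

/-- The tuples of messages. -/
abbrev Msg (c : Code P n) : Type _ := ∀ i : ι, Fin (c.msgCard i)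

/-- The sample space: all messages and all keys. -/
abbrev Sample (c : Code P n) : Type _ := c.Msg × (∀ v : V, Fin (c.keyCard v))

/-- The bit on link `e` in time slot `t`. -/
def signal (c : Code P n) (ω : c.Sample) (e : E) (t : Fin n) : Bool :=
  c.encode e t (fun i => ω.1 i) (ω.2 (P.tail e))
    (fun e' s => c.signal ω e' ⟨s, s.isLt.trans t.isLt⟩)
termination_by (t : ℕ)
decreasing_by exact s.isLt

/-- The estimate of message `i` at its destination. -/
def output (c : Code P n) (ω : c.Sample) (i : ι) : Fin (c.msgCard i) :=
  c.decode i (fun j => ω.1 j) (ω.2 (P.dst i)) (fun e' t => c.signal ω e' t)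

/-- The signals `X^n(A)` on the set `A` of links. -/
def observed (c : Code P n) (A : Finset E) (ω : c.Sample) : A → Fin n → Bool :=
  fun e t => c.signal ω e t

/-- The rate of message `i`, in bits per time slot. -/
noncomputable def rate (c : Code P n) (i : ι) : ℝ :=
  Real.logb 2 (c.msgCard i) / n

variable [Fintype V] [Fintype ι] [DecidableEq V] [DecidableEq ι]

/-- The probability of a sample point: uniform messages and independent keys. -/
noncomputable def weight (c : Code P n) (ω : c.Sample) : ℝ :=
  (∏ i, (c.msgCard i : ℝ)⁻¹) * ∏ v, c.keyProb v (ω.2 v)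

open Classical in
/-- The probability of an event. -/
noncomputable def prob (c : Code P n) (S : c.Sample → Prop) : ℝ :=
  ∑ ω : c.Sample, if S ω then c.weight ω else 0

/-- The probability that message `i` is decoded incorrectly. -/
noncomputable def errorProb (c : Code P n) (i : ι) : ℝ :=
  c.prob fun ω => c.output ω i ≠ ω.1 i

/-- The Shannon entropy `H(X)`, in bits, of a random variable with a finite range. -/
noncomputable def entropy (c : Code P n) {α : Type*} [Fintype α] (X : c.Sample → α) : ℝ :=
  ∑ a, Real.negMulLog (c.prob fun ω => X ω = a) / Real.log 2

/-- The mutual information `I(X;Y) = H(X) + H(Y) - H(X,Y)`, in bits. -/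
noncomputable def mutualInfo (c : Code P n) {α β : Type*} [Fintype α] [Fintype β]
    (X : c.Sample → α) (Y : c.Sample → β) : ℝ :=
  c.entropy X + c.entropy Y - c.entropy fun ω => (X ω, Y ω)

/-- The information `I(M;X^n(A))` on the messages leaked by the links in `A`. -/
noncomputable def leakage [DecidableEq E] (c : Code P n) (A : Finset E) : ℝ :=
  c.mutualInfo (fun ω => ω.1) (c.observed A)

end Code

/-- The three secrecy requirements. -/
inductive Secrecy where
  | perfect
  | strong
  | weak

/-- A sequence of leakages `I(M;X^n(A))`, indexed by the length `n`, meets the requirement. -/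
def Secrecy.Holds : Secrecy → (ℕ → ℝ) → Prop
  | perfect, l => ∀ n, l n = 0
  | strong, l => Filter.Tendsto l Filter.atTop (nhds 0)
  | weak, l => Filter.Tendsto (fun n => l n / n) Filter.atTop (nhds 0)

namespace CommProblem

variable {V E ι : Type*} [Fintype V] [Fintype ι] [DecidableEq V] [DecidableEq ι]

/-- `c` is a sequence of codes of lengths `n = 0, 1, 2, …` that communicates at the rates `R`:
the rates `n⁻¹ log₂ |𝒮ₙ|` tend to `R` and the error probabilities tend to `0`. -/
def Communicates (P : CommProblem V E ι) (R : ι → ℝ) (c : ∀ n, Code P n) : Prop :=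
  ∀ i, Filter.Tendsto (fun n => (c n).rate i) Filter.atTop (nhds (R i)) ∧
    Filter.Tendsto (fun n => (c n).errorProb i) Filter.atTop (nhds 0)

/-- The rates `R` are feasible. -/
def Feasible (P : CommProblem V E ι) (R : ι → ℝ) : Prop :=
  ∃ c : ∀ n, Code P n, P.Communicates R c

/-- The common rate `R` for all messages is feasible with secrecy requirement `σ` against an
eavesdropper that observes any one set of links of the collection `𝒜`. -/
def SecrecyFeasible [DecidableEq E] (P : CommProblem V E ι) (𝒜 : Set (Finset E)) (σ : Secrecy)
    (R : ℝ) : Prop :=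
  ∃ c : ∀ n, Code P n, P.Communicates (fun _ => R) c ∧
    ∀ A ∈ 𝒜, σ.Holds fun n => (c n).leakage A

/-- `C` is the secrecy capacity: the supremum of the feasible secrecy rates. -/
def IsSecrecyCapacity [DecidableEq E] (P : CommProblem V E ι) (𝒜 : Set (Finset E)) (σ : Secrecy)
    (C : ℝ) : Prop :=
  IsLUB {R : ℝ | P.SecrecyFeasible 𝒜 σ R} C

end CommProblem

/-- The wiretap sets when any single link may be wiretapped. -/
def singleLinks (E : Type*) : Set (Finset E) := {A | ∃ e : E, A = {e}}

/-- The vertices of the secure network: those of the embedded network, the source `S`, the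
destination `D`, and four further vertices for each of the `K` source-destination pairs. -/
inductive SecureNode (V : Type*) (K : ℕ) where
  | S
  | D
  | A (i : Fin K)
  | B (i : Fin K)
  | C (i : Fin K)
  | F (i : Fin K)
  | inner (v : V)
  deriving DecidableEq, Fintype

/-- The links of the secure network, see `secureUnicast` for their end points. -/
inductive SecureLink (E : Type*) (K : ℕ) where
  | a (i : Fin K) (j : Fin 2)
  | b (i : Fin K)
  | b' (i : Fin K)
  | c (i : Fin K)
  | d (i : Fin K)
  | e (i : Fin K)
  | f (i : Fin K)
  | f' (i : Fin K)
  | inner (e : E)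
  deriving DecidableEq

/-- The single-unicast problem into which a `K`-unicast problem with sources `Sᵢ` and destinations
`Tᵢ` is embedded. For each `i` the links outside the embedded network are: two parallel links
`S → Aᵢ`; the key links `Bᵢ → Aᵢ` and `Bᵢ → Sᵢ`; `cᵢ : Aᵢ → Cᵢ`; `dᵢ : Tᵢ → Cᵢ`; the key links
`Fᵢ → D` and `Fᵢ → Cᵢ`; and `eᵢ : Cᵢ → D`. -/
def secureUnicast {V E : Type*} {K : ℕ} (N : CommProblem V E (Fin K)) :
    CommProblem (SecureNode V K) (SecureLink E K) Unit where
  tail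
    | .a _ _ => .S
    | .b i => .B i
    | .b' i => .B i
    | .c i => .A i
    | .d i => .inner (N.dst i)
    | .e i => .C i
    | .f i => .F i
    | .f' i => .F i
    | .inner e => .inner (N.tail e)
  head
    | .a i _ => .A i
    | .b i => .A i
    | .b' i => .inner (N.src i)
    | .c i => .C i
    | .d i => .C i
    | .e _ => .D
    | .f _ => .D
    | .f' i => .C i
    | .inner e => .inner (N.head e)
  src _ := .S
  dst _ := .D

/-!
The theorem splits into an upper bound, a construction and a converse.

*Upper bound.* For fixed keys the output at `D` is a function of the `n K` bits on the links
`e₁, …, e_K`, so at most `2 ^ (n K)` messages can be decoded correctly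
(`Code.one_sub_errorProb_mul_msgCard_le`), and no feasible rate exceeds `K`.

*Construction* (`secrecyFeasible_of_feasible`). Given codes for the unicast problem, each `Bᵢ` sends
a stream of uniform key bits `κᵢ` to `Aᵢ` and `Sᵢ`. The embedded network conveys `κᵢ` to `Tᵢ`, block
by block, while `cᵢ` carries `Mᵢ + κᵢ`; the link `eᵢ` carries `cᵢ + dᵢ + Fᵢ = Mᵢ + Fᵢ`, from which `D`
removes the key `Fᵢ`. Every single link is independent of the message, because a change of the
message is compensated by the same change of a key (`pipeline_leakage`). As the blocks are processed
in a pipeline with a delay of three block lengths, the loss of rate vanishes for many blocks. Errors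
only arise in the runs of the unicast code; that code is first restricted to uniform bit strings
and fixed keys by averaging (`Code.exists_restriction`).

*Converse* (`feasible_of_secrecyFeasible`). It suffices that the leakage on the links `cᵢ` is small
compared with `n`. By Fano's inequality, `(cᵢ, dᵢ)` must carry nearly `n` bits on the message `M`,
since the other links `eⱼ` carry at most `n (K - 1)` bits. As `cᵢ` alone reveals almost nothing, the
mutual information of `(M, cᵢ)` and `dᵢ` is nearly `n`. But `dᵢ` depends on `(M, cᵢ)` only through
the key of `Bᵢ`, so this key and `dᵢ` have nearly `n` bits of mutual information
(`Code.ent_d_given_key_le`). This is the largest possible value for the `n` bits of `dᵢ`; hence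
Markov's inequality alone shows that, with high probability, `dᵢ` has conditional probability
`2 ^ (-o(n))` given the key while its probability is at most `2 ^ (-n + o(n))`. A random codebook of
keys with threshold decoding of `dᵢ` therefore transmits `n - o(n)` bits from `Sᵢ` to `Tᵢ` for all
`i` at once (`Code.average_error_le`), without any repetition of the secure code. Fixing the codebook
and all keys by averaging yields a code of the same length for the unicast problem, in which `Sᵢ`
plays the part of `Bᵢ` (`Code.simulation`).
-/

/-! ### Finite probability and entropy -/

section FiniteProbability

variable {Ω α β γ : Type*} [Fintype Ω]

open Classical in
/-- The probability that `X = a` if the sample point `ω` has probability `p ω`. -/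
noncomputable def law (p : Ω → ℝ) (X : Ω → α) (a : α) : ℝ :=
  ∑ ω, if X ω = a then p ω else 0

/-- The Shannon entropy of `X`, in nats. -/
noncomputable def ent [Fintype α] (p : Ω → ℝ) (X : Ω → α) : ℝ :=
  ∑ a, Real.negMulLog (law p X a)

theorem law_nonneg {p : Ω → ℝ} (hp : ∀ ω, 0 ≤ p ω) (X : Ω → α) (a : α) : 0 ≤ law p X a :=
  Finset.sum_nonneg fun ω _ => by split_ifs <;> simp [hp]

theorem sum_law_mul [Fintype α] (p : Ω → ℝ) (X : Ω → α) (f : α → ℝ) :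
    ∑ a, law p X a * f a = ∑ ω, p ω * f (X ω) := by
  classical
  simp only [law, Finset.sum_mul]
  rw [Finset.sum_comm]
  refine Finset.sum_congr rfl fun ω _ => ?_
  simp [ite_mul]

theorem sum_law [Fintype α] (p : Ω → ℝ) (X : Ω → α) : ∑ a, law p X a = ∑ ω, p ω := by
  simpa using sum_law_mul p X fun _ => 1

theorem le_law {p : Ω → ℝ} (hp : ∀ ω, 0 ≤ p ω) (X : Ω → α) (ω : Ω) : p ω ≤ law p X (X ω) := by
  classical
  have := Finset.single_le_sum (f := fun ω' => if X ω' = X ω then p ω' else 0)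
    (fun ω' _ => by split_ifs <;> simp [hp]) (Finset.mem_univ ω)
  simpa [law] using this

/-- Passing to a coarser random variable increases the probability of the observed value. -/
theorem law_mono {p : Ω → ℝ} (hp : ∀ ω, 0 ≤ p ω) {X : Ω → α} {Y : Ω → β}
    (h : ∀ ω ω', X ω = X ω' → Y ω = Y ω') (ω : Ω) : law p X (X ω) ≤ law p Y (Y ω) := by
  classical
  refine Finset.sum_le_sum fun ω' _ => ?_
  by_cases hX : X ω' = X ω
  · simp [hX, h _ _ hX]
  · rw [if_neg hX]; split_ifs <;> simp [hp]

theorem sum_law_pair_right [Fintype β] (p : Ω → ℝ) (X : Ω → α) (Y : Ω → β) (a : α) :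
    ∑ b, law p (fun ω => (X ω, Y ω)) (a, b) = law p X a := by
  classical
  simp only [law]
  rw [Finset.sum_comm]
  refine Finset.sum_congr rfl fun ω _ => ?_
  by_cases h : X ω = a <;> simp [h]

theorem sum_law_pair_left [Fintype α] (p : Ω → ℝ) (X : Ω → α) (Y : Ω → β) (b : β) :
    ∑ a, law p (fun ω => (X ω, Y ω)) (a, b) = law p Y b := by
  classical
  simp only [law]
  rw [Finset.sum_comm]
  refine Finset.sum_congr rfl fun ω _ => ?_
  by_cases h : Y ω = b <;> simp [h]

theorem law_pair_le_left {p : Ω → ℝ} (hp : ∀ ω, 0 ≤ p ω) (X : Ω → α) (Y : Ω → β) (a : α) (b : β) :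
    law p (fun ω => (X ω, Y ω)) (a, b) ≤ law p X a := by
  classical
  refine Finset.sum_le_sum fun ω _ => ?_
  by_cases h : X ω = a
  · simp only [h, Prod.mk.injEq, true_and, if_true]; split_ifs <;> simp [hp]
  · simp [h]

theorem ent_eq_sum [Fintype α] (p : Ω → ℝ) (X : Ω → α) :
    ent p X = ∑ ω, p ω * -Real.log (law p X (X ω)) := by
  rw [← sum_law_mul p X fun a => -Real.log (law p X a)]
  simp [ent, Real.negMulLog]

/-- Gibbs' inequality. -/
theorem ent_le_cross [Fintype α] {p : Ω → ℝ} (hp : ∀ ω, 0 ≤ p ω) (X : Ω → α) {q : α → ℝ}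
    (hq : ∀ a, 0 ≤ q a) (hpq : ∀ ω, 0 < p ω → 0 < q (X ω)) (hsum : ∑ a, q a ≤ ∑ ω, p ω) :
    ent p X ≤ ∑ ω, p ω * -Real.log (q (X ω)) := by
  rw [← sum_law_mul p X fun a => -Real.log (q a)]
  have key : ∀ a, Real.negMulLog (law p X a) ≤ law p X a * -Real.log (q a) + (q a - law p X a) := by
    intro a
    rcases (law_nonneg hp X a).eq_or_lt with h | h
    · simp [← h, hq a]
    · have hqa : 0 < q a := by
        by_contra hqa
        refine h.ne' (Finset.sum_eq_zero fun ω _ => ?_)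
        split_ifs with hω
        · by_contra hω'
          exact hqa (hω ▸ hpq ω (lt_of_le_of_ne (hp ω) (Ne.symm hω')))
        · rfl
      have h1 := Real.log_le_sub_one_of_pos (div_pos hqa h)
      rw [Real.log_div hqa.ne' h.ne'] at h1
      have h2 := mul_le_mul_of_nonneg_left h1 h.le
      have h3 : law p X a * (q a / law p X a - 1) = q a - law p X a := by field_simp
      rw [h3] at h2
      simp only [Real.negMulLog]
      linarith
  have := Finset.sum_le_sum fun a (_ : a ∈ Finset.univ) => key a
  rw [Finset.sum_add_distrib, Finset.sum_sub_distrib, sum_law] at this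
  simp only [ent]
  linarith

theorem law_pos {p : Ω → ℝ} (hp : ∀ ω, 0 ≤ p ω) (X : Ω → α) {ω : Ω} (h : 0 < p ω) :
    0 < law p X (X ω) :=
  h.trans_le (le_law hp X ω)

theorem sum_mul_congr {p : Ω → ℝ} (hp : ∀ ω, 0 ≤ p ω) {f g : Ω → ℝ}
    (h : ∀ ω, 0 < p ω → f ω = g ω) : ∑ ω, p ω * f ω = ∑ ω, p ω * g ω := by
  refine Finset.sum_congr rfl fun ω _ => ?_
  rcases (hp ω).eq_or_lt with h0 | h0
  · simp [← h0]
  · rw [h ω h0]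

theorem sum_mul_mono {p : Ω → ℝ} (hp : ∀ ω, 0 ≤ p ω) {f g : Ω → ℝ}
    (h : ∀ ω, 0 < p ω → f ω ≤ g ω) : ∑ ω, p ω * f ω ≤ ∑ ω, p ω * g ω := by
  refine Finset.sum_le_sum fun ω _ => ?_
  rcases (hp ω).eq_or_lt with h0 | h0
  · simp [← h0]
  · exact mul_le_mul_of_nonneg_left (h ω h0) h0.le

theorem ent_le_log_card [Fintype α] {p : Ω → ℝ} (hp : ∀ ω, 0 ≤ p ω) (hp1 : ∑ ω, p ω = 1)
    (X : Ω → α) : ent p X ≤ Real.log (Fintype.card α) := by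
  have hΩ : Nonempty Ω := by
    by_contra h
    rw [not_nonempty_iff] at h
    simp at hp1
  have : Nonempty α := hΩ.map X
  have hc : (0 : ℝ) < Fintype.card α := by exact_mod_cast Fintype.card_pos
  refine (ent_le_cross hp X (q := fun _ => (Fintype.card α : ℝ)⁻¹) (fun _ => by positivity)
    (fun _ _ => by positivity) ?_).trans_eq ?_
  · simp [hp1, hc.ne']
  · simp [← Finset.sum_mul, hp1]

theorem ent_pair_le [Fintype α] [Fintype β] {p : Ω → ℝ} (hp : ∀ ω, 0 ≤ p ω)
    (hp1 : ∑ ω, p ω = 1) (X : Ω → α) (Y : Ω → β) :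
    ent p (fun ω => (X ω, Y ω)) ≤ ent p X + ent p Y := by
  refine (ent_le_cross hp _ (q := fun a => law p X a.1 * law p Y a.2)
    (fun a => mul_nonneg (law_nonneg hp _ _) (law_nonneg hp _ _))
    (fun ω h => mul_pos (law_pos hp X h) (law_pos hp Y h)) ?_).trans_eq ?_
  · rw [Fintype.sum_prod_type]
    simp [← Finset.mul_sum, sum_law, hp1]
  · rw [ent_eq_sum, ent_eq_sum, ← Finset.sum_add_distrib]
    simp_rw [← mul_add]
    refine sum_mul_congr hp fun ω h => ?_
    rw [Real.log_mul (law_pos hp X h).ne' (law_pos hp Y h).ne']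
    ring

theorem ent_pair_of_indep [Fintype α] [Fintype β] {p : Ω → ℝ} (hp : ∀ ω, 0 ≤ p ω)
    (X : Ω → α) (Y : Ω → β)
    (h : ∀ a b, law p (fun ω => (X ω, Y ω)) (a, b) = law p X a * law p Y b) :
    ent p (fun ω => (X ω, Y ω)) = ent p X + ent p Y := by
  rw [ent_eq_sum, ent_eq_sum, ent_eq_sum, ← Finset.sum_add_distrib]
  simp_rw [← mul_add, h]
  refine sum_mul_congr hp fun ω h => ?_
  rw [Real.log_mul (law_pos hp X h).ne' (law_pos hp Y h).ne']
  ring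

theorem ent_mono [Fintype α] [Fintype β] {p : Ω → ℝ} (hp : ∀ ω, 0 ≤ p ω) {X : Ω → α} {Y : Ω → β}
    (h : ∀ ω ω', X ω = X ω' → Y ω = Y ω') : ent p Y ≤ ent p X := by
  rw [ent_eq_sum, ent_eq_sum]
  exact sum_mul_mono hp fun ω hω =>
    neg_le_neg (Real.log_le_log (law_pos hp X hω) (law_mono hp h ω))

theorem ent_congr [Fintype α] [Fintype β] {p : Ω → ℝ} (hp : ∀ ω, 0 ≤ p ω) {X : Ω → α} {Y : Ω → β}
    (h : ∀ ω ω', X ω = X ω' ↔ Y ω = Y ω') : ent p X = ent p Y :=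
  (ent_mono hp fun _ _ h' => (h _ _).2 h').antisymm (ent_mono hp fun _ _ h' => (h _ _).1 h')

/-- Conditioning on a finer random variable `W` decreases the conditional entropy of `D`. -/
theorem ent_cond_le [Fintype α] [Fintype β] [Fintype γ] {p : Ω → ℝ} (hp : ∀ ω, 0 ≤ p ω)
    {W : Ω → α} {U : Ω → β} (D : Ω → γ) (hWU : ∀ ω ω', W ω = W ω' → U ω = U ω') :
    ent p (fun ω => (W ω, D ω)) - ent p W ≤ ent p (fun ω => (U ω, D ω)) - ent p U := by
  rcases isEmpty_or_nonempty Ω with hΩ | hΩ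
  · simp [ent_eq_sum]
  have : Nonempty β := hΩ.map U
  obtain ⟨f, rfl⟩ := (Function.factorsThrough_iff U).1 fun ω ω' h => hWU ω ω' h
  have := ent_le_cross hp (fun ω => (W ω, D ω))
    (q := fun a => law p W a.1 * (law p (fun ω => (f (W ω), D ω)) (f a.1, a.2) /
      law p (fun ω => f (W ω)) (f a.1)))
    (fun a => mul_nonneg (law_nonneg hp _ _) (div_nonneg (law_nonneg hp _ _) (law_nonneg hp _ _)))
    (fun ω h => mul_pos (law_pos hp W h) (div_pos (law_pos hp (fun ω => (f (W ω), D ω)) h)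
      (law_pos hp (fun ω => f (W ω)) h))) ?_
  · have h2 : ∑ ω, p ω * -Real.log (law p W (W ω) * (law p (fun ω => (f (W ω), D ω))
        (f (W ω), D ω) / law p (fun ω => f (W ω)) (f (W ω)))) =
        ent p W + ent p (fun ω => (f (W ω), D ω)) - ent p (fun ω => f (W ω)) := by
      rw [ent_eq_sum p W, ent_eq_sum, ent_eq_sum, ← Finset.sum_add_distrib,
        ← Finset.sum_sub_distrib]
      simp_rw [← mul_add, ← mul_sub]
      refine sum_mul_congr hp fun ω h => ?_
      have h1 := law_pos hp (fun ω => (f (W ω), D ω)) h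
      have h3 := law_pos hp (fun ω => f (W ω)) h
      rw [Real.log_mul (law_pos hp W h).ne' (div_pos h1 h3).ne', Real.log_div h1.ne' h3.ne']
      ring
    simp only [Function.comp_apply, Function.comp_def] at this ⊢
    linarith
  · rw [Fintype.sum_prod_type, ← sum_law p W]
    refine Finset.sum_le_sum fun a _ => ?_
    simp only
    rw [← Finset.mul_sum, ← Finset.sum_div, sum_law_pair_right p (fun ω => f (W ω)) D]
    exact mul_le_of_le_one_right (law_nonneg hp _ _) (div_self_le_one _)

open Classical in
/-- Fano's inequality for an estimate of `M` that is determined by `Y`. -/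
theorem fano [Fintype α] [Fintype β] {p : Ω → ℝ} (hp : ∀ ω, 0 ≤ p ω) (hp1 : ∑ ω, p ω = 1)
    (M est : Ω → α) (Y : Ω → β) (hest : ∀ ω ω', Y ω = Y ω' → est ω = est ω') :
    ent p (fun ω => (M ω, Y ω)) - ent p Y ≤
      Real.log 2 + (∑ ω, if est ω ≠ M ω then p ω else 0) * Real.log (Fintype.card α) := by
  have hΩ : Nonempty Ω := by
    by_contra h
    rw [not_nonempty_iff] at h
    simp at hp1
  have : Nonempty α := hΩ.map M
  have hc : (0 : ℝ) < Fintype.card α := by exact_mod_cast Fintype.card_pos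
  obtain ⟨g, rfl⟩ := (Function.factorsThrough_iff est).1 fun ω ω' h => hest ω ω' h
  -- the guess `g y` is given conditional probability `1/2`, the rest is spread evenly
  have := ent_le_cross hp (fun ω => (M ω, Y ω))
    (q := fun a => law p Y a.2 * ((if g a.2 = a.1 then 2⁻¹ else 0) + (2 * Fintype.card α : ℝ)⁻¹))
    (fun a => mul_nonneg (law_nonneg hp _ _) (by positivity))
    (fun ω h => mul_pos (law_pos hp Y h) (by positivity)) ?_
  · refine (sub_le_sub_right this _).trans ?_
    rw [ent_eq_sum, ← Finset.sum_sub_distrib, ← mul_one (Real.log 2), ← hp1, Finset.mul_sum,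
      Finset.sum_mul, ← Finset.sum_add_distrib]
    refine Finset.sum_le_sum fun ω _ => ?_
    rcases (hp ω).eq_or_lt with h0 | h0
    · simp [← h0]
    have hY := law_pos hp Y h0
    simp only [Function.comp_apply]
    have hq : (0 : ℝ) < (if g (Y ω) = M ω then 2⁻¹ else 0) + (2 * Fintype.card α : ℝ)⁻¹ := by
      positivity
    rw [Real.log_mul hY.ne' hq.ne']
    have e1 : p ω * -(Real.log (law p Y (Y ω)) + Real.log ((if g (Y ω) = M ω then 2⁻¹ else 0) +
        (2 * Fintype.card α : ℝ)⁻¹)) - p ω * -Real.log (law p Y (Y ω)) =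
        p ω * -Real.log ((if g (Y ω) = M ω then 2⁻¹ else 0) + (2 * Fintype.card α : ℝ)⁻¹) := by
      ring
    rw [e1]
    by_cases h : g (Y ω) = M ω
    · simp only [h, if_true, ne_eq, not_true, if_false, zero_mul, add_zero]
      rw [mul_comm]
      refine mul_le_mul_of_nonneg_right ?_ h0.le
      rw [neg_le, ← Real.log_inv]
      exact Real.log_le_log (by positivity) (le_add_of_nonneg_right (by positivity))
    · simp only [h, if_false, ne_eq, not_false_eq_true, if_true, zero_add]
      rw [Real.log_inv, Real.log_mul (by norm_num) hc.ne']
      apply le_of_eq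
      ring
  · rw [Fintype.sum_prod_type_right, ← sum_law p Y]
    refine Finset.sum_le_sum fun b _ => ?_
    simp only
    rw [← Finset.mul_sum, Finset.sum_add_distrib]
    refine mul_le_of_le_one_right (law_nonneg hp _ _) ?_
    simp only [Finset.sum_ite_eq, Finset.mem_univ, if_true, Finset.sum_const, Finset.card_univ,
      nsmul_eq_mul]
    apply le_of_eq
    field_simp
    norm_num

/-- Two random variables are independent if exchanging the coordinates on which the first one
depends between two independent copies of the sample point is an operation `mix` that preserves
probabilities. -/
theorem law_pair_of_mix {p : Ω → ℝ} (hp1 : ∑ ω, p ω = 1) (mix : Ω → Ω → Ω)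
    (hmix : ∀ ω ω', mix (mix ω ω') (mix ω' ω) = ω)
    (hw : ∀ ω ω', p (mix ω ω') * p (mix ω' ω) = p ω * p ω')
    (X : Ω → α) (Y : Ω → β) (hX : ∀ ω ω', X (mix ω ω') = X ω) (hY : ∀ ω ω', Y (mix ω ω') = Y ω')
    (a : α) (b : β) :
    law p (fun ω => (X ω, Y ω)) (a, b) = law p X a * law p Y b := by
  classical
  let τ : Equiv.Perm (Ω × Ω) := Function.Involutive.toPerm
    (fun z => (mix z.1 z.2, mix z.2 z.1)) (fun z => by simp [hmix])
  calc law p (fun ω => (X ω, Y ω)) (a, b)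
      = ∑ z : Ω × Ω, if X z.1 = a ∧ Y z.1 = b then p z.1 * p z.2 else 0 := by
        rw [Fintype.sum_prod_type]
        refine Finset.sum_congr rfl fun ω _ => ?_
        by_cases h : X ω = a ∧ Y ω = b <;> simp [h, ← Finset.mul_sum, hp1]
    _ = ∑ z : Ω × Ω, if X z.1 = a ∧ Y z.2 = b then p z.1 * p z.2 else 0 := by
        rw [← Equiv.sum_comp τ]
        refine Finset.sum_congr rfl fun z _ => ?_
        simp [τ, Function.Involutive.toPerm, hX, hY, hw]
    _ = law p X a * law p Y b := by
        rw [law, law, Finset.sum_mul_sum, Fintype.sum_prod_type]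
        refine Finset.sum_congr rfl fun ω _ => Finset.sum_congr rfl fun ω' _ => ?_
        by_cases h : X ω = a <;> by_cases h' : Y ω' = b <;> simp [h, h']

end FiniteProbability

/-! ### Threshold decoding -/

section ThresholdDecoding

variable {Ω α β : Type*} [Fintype Ω]

/-- The input value `x` is plausible for the output value `y` if the conditional probability of `y`
given `x` is at least `τ`. -/
def Plausible (p : Ω → ℝ) (X : Ω → α) (Y : Ω → β) (τ : ℝ) (x : α) (y : β) : Prop :=
  τ * law p X x ≤ law p (fun ω => (X ω, Y ω)) (x, y)

open Classical in
/-- Markov's inequality for `-log p(Y | X)`: a small conditional entropy makes the true input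
plausible. -/
theorem prob_not_plausible_mul_le [Fintype α] [Fintype β] {p : Ω → ℝ} (hp : ∀ ω, 0 ≤ p ω)
    (X : Ω → α) (Y : Ω → β) {τ : ℝ} (hτ : 0 < τ) :
    (∑ ω, if ¬Plausible p X Y τ (X ω) (Y ω) then p ω else 0) * -Real.log τ ≤
      ent p (fun ω => (X ω, Y ω)) - ent p X := by
  rw [ent_eq_sum, ent_eq_sum, ← Finset.sum_sub_distrib, Finset.sum_mul]
  refine Finset.sum_le_sum fun ω _ => ?_
  rcases (hp ω).eq_or_lt with h0 | h0
  · simp [← h0]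
  have h1 := law_pos hp X h0
  have h2 := law_pos hp (fun ω => (X ω, Y ω)) h0
  rw [← mul_sub]
  by_cases h : ¬Plausible p X Y τ (X ω) (Y ω)
  · rw [if_pos h]
    refine mul_le_mul_of_nonneg_left ?_ h0.le
    rw [Plausible, not_le] at h
    have := Real.log_le_log h2 h.le
    rw [Real.log_mul hτ.ne' h1.ne'] at this
    linarith
  · rw [if_neg h, zero_mul]
    refine mul_nonneg h0.le ?_
    have := Real.log_le_log h2 (law_pair_le_left hp X Y _ _)
    linarith

open Classical in
/-- If the entropy of `Y` is nearly maximal, then the observed value of `Y` is unlikely to have a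
probability far above the uniform one. -/
theorem prob_lt_law_mul_le [Fintype β] {p : Ω → ℝ} (hp : ∀ ω, 0 ≤ p ω) (hp1 : ∑ ω, p ω = 1)
    (Y : Ω → β) {s : ℝ} (hs : 0 < s) :
    (∑ ω, if s < law p Y (Y ω) then p ω else 0) * Real.log (s * Fintype.card β) ≤
      Real.log (Fintype.card β) - ent p Y + 1 := by
  have hΩ : Nonempty Ω := by
    by_contra h
    rw [not_nonempty_iff] at h
    simp at hp1
  have : Nonempty β := hΩ.map Y
  have hc : (0 : ℝ) < Fintype.card β := by exact_mod_cast Fintype.card_pos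
  have h1 : (∑ ω, if s < law p Y (Y ω) then p ω else 0) =
      ∑ y, law p Y y * if s < law p Y y then 1 else 0 := by
    rw [sum_law_mul p Y fun y => if s < law p Y y then 1 else 0]
    simp
  have h2 : Real.log (Fintype.card β) - ent p Y + 1 =
      ∑ y, (law p Y y * Real.log (Fintype.card β) - Real.negMulLog (law p Y y) +
        (Fintype.card β : ℝ)⁻¹) := by
    rw [Finset.sum_add_distrib, Finset.sum_sub_distrib, ← Finset.sum_mul, sum_law, hp1, ent]
    simp [hc.ne']
  rw [h1, h2, Finset.sum_mul]
  refine Finset.sum_le_sum fun y _ => ?_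
  rcases (law_nonneg hp Y y).eq_or_lt with h0 | h0
  · simp [← h0]
  have e : law p Y y * Real.log (Fintype.card β) - Real.negMulLog (law p Y y) =
      law p Y y * Real.log (law p Y y * Fintype.card β) := by
    rw [Real.log_mul h0.ne' hc.ne', Real.negMulLog]
    ring
  rw [e]
  split_ifs with h
  · rw [mul_one]
    have := mul_le_mul_of_nonneg_left (Real.log_le_log (mul_pos hs hc)
      (mul_le_mul_of_nonneg_right h.le hc.le)) h0.le
    have := inv_pos.2 hc
    linarith
  · rw [mul_zero, zero_mul]
    have h3 := Real.one_sub_inv_le_log_of_pos (mul_pos h0 hc)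
    have h4 := mul_le_mul_of_nonneg_left h3 h0.le
    have h5 : law p Y y * (1 - (law p Y y * Fintype.card β)⁻¹) =
        law p Y y - (Fintype.card β : ℝ)⁻¹ := by field_simp
    linarith

open Classical in
/-- An input that is independent of the output is unlikely to be plausible. -/
theorem prob_plausible_indep_le [Fintype α] [Fintype β] {p : Ω → ℝ} (hp : ∀ ω, 0 ≤ p ω)
    (hp1 : ∑ ω, p ω = 1) (X : Ω → α) (Y : Ω → β) {s τ : ℝ} (hs : 0 ≤ s) (hτ : 0 < τ) :
    (∑ ω, ∑ x, if law p Y (Y ω) ≤ s ∧ Plausible p X Y τ x (Y ω) then p ω * law p X x else 0) ≤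
      s / τ := by
  have key : ∀ ω, (∑ x, if law p Y (Y ω) ≤ s ∧ Plausible p X Y τ x (Y ω) then
      p ω * law p X x else 0) ≤ p ω * (s / τ) := by
    intro ω
    by_cases h : law p Y (Y ω) ≤ s
    · simp only [h, true_and]
      have : ∀ x, (if Plausible p X Y τ x (Y ω) then p ω * law p X x else 0) ≤
          p ω * (law p (fun ω => (X ω, Y ω)) (x, Y ω) / τ) := by
        intro x
        split_ifs with hx
        · refine mul_le_mul_of_nonneg_left ?_ (hp ω)
          rw [le_div_iff₀ hτ, mul_comm]
          exact hx
        · exact mul_nonneg (hp ω) (div_nonneg (law_nonneg hp _ _) hτ.le)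
      refine (Finset.sum_le_sum fun x _ => this x).trans ?_
      rw [← Finset.mul_sum, ← Finset.sum_div, sum_law_pair_left]
      gcongr
      exact hp ω
    · simp only [h, false_and, if_false, Finset.sum_const_zero]
      exact mul_nonneg (hp ω) (by positivity)
  refine (Finset.sum_le_sum fun ω _ => key ω).trans_eq ?_
  rw [← Finset.sum_mul, hp1, one_mul]

end ThresholdDecoding

/-! ### Product weights and averaging -/

section ProductWeights

variable {J : Type*} [Fintype J] [DecidableEq J] {α : J → Type*} [∀ j, Fintype (α j)]

theorem sum_prod_weight {p : ∀ j, α j → ℝ} (hp1 : ∀ j, ∑ x, p j x = 1) :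
    ∑ x : ∀ j, α j, ∏ j, p j (x j) = 1 := by
  rw [← Fintype.piFinset_univ, ← Finset.prod_univ_sum fun _ => Finset.univ]
  simp [hp1]

/-- The marginal distribution of one coordinate under a product of distributions. -/
theorem sum_prod_weight_mul {p : ∀ j, α j → ℝ} (hp1 : ∀ j, ∑ x, p j x = 1) (j : J) (f : α j → ℝ) :
    ∑ x : ∀ j, α j, (∏ j, p j (x j)) * f (x j) = ∑ y, p j y * f y := by
  classical
  let q : ∀ j', α j' → ℝ := fun j' y => p j' y * if h : j' = j then f (h ▸ y) else 1
  have h1 : ∀ x : ∀ j, α j, (∏ j, p j (x j)) * f (x j) = ∏ j', q j' (x j') := by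
    intro x
    simp only [q, Finset.prod_mul_distrib]
    congr 1
    rw [Finset.prod_eq_single j]
    · simp
    · intro b _ hb
      simp [hb]
    · simp
  simp_rw [h1]
  rw [← Fintype.piFinset_univ, ← Finset.prod_univ_sum fun _ => Finset.univ,
    Finset.prod_eq_single j]
  · simp [q]
  · intro b _ hb
    simp [q, hb, hp1]
  · simp

end ProductWeights

/-- Some value of a function is at most its weighted average. -/
theorem exists_le_of_sum_le {Ω : Type*} [Fintype Ω] {p : Ω → ℝ} (hp : ∀ ω, 0 ≤ p ω)
    (hp1 : ∑ ω, p ω = 1) {f : Ω → ℝ} {b : ℝ} (h : ∑ ω, p ω * f ω ≤ b) : ∃ ω, f ω ≤ b := by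
  by_contra! hf
  have hne : ∃ ω, p ω ≠ 0 := by
    by_contra! h0
    simp [h0] at hp1
  obtain ⟨ω₀, h₀⟩ := hne
  have : ∑ ω, p ω * b < ∑ ω, p ω * f ω :=
    Finset.sum_lt_sum (fun ω _ => mul_le_mul_of_nonneg_left (hf ω).le (hp ω))
      ⟨ω₀, Finset.mem_univ _, mul_lt_mul_of_pos_left (hf ω₀) (lt_of_le_of_ne (hp ω₀) h₀.symm)⟩
  rw [← Finset.sum_mul, hp1, one_mul] at this
  linarith

/-- If codes of arbitrarily small defect exist at all large lengths, then there is a sequence of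
codes whose defect tends to `0`. -/
theorem exists_seq_tendsto_zero {C : ℕ → Type*} [∀ n, Nonempty (C n)] (f : ∀ n, C n → ℝ)
    (hf : ∀ n c, 0 ≤ f n c)
    (h : ∀ η > 0, ∀ᶠ n in Filter.atTop, ∃ c : C n, f n c ≤ η) :
    ∃ c : ∀ n, C n, Filter.Tendsto (fun n => f n (c n)) Filter.atTop (nhds 0) := by
  have h1 : ∀ n : ℕ, ∃ c : C n, f n c < (⨅ c, f n c) + 1 / ((n : ℝ) + 1) := fun n =>
    exists_lt_of_ciInf_lt (lt_add_of_pos_right _ (by positivity))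
  choose c hc using h1
  refine ⟨c, ?_⟩
  have hinf : Filter.Tendsto (fun n => ⨅ c, f n c) Filter.atTop (nhds 0) := by
    rw [Metric.tendsto_atTop']
    intro ε hε
    obtain ⟨N, hN⟩ := Filter.eventually_atTop.1 (h (ε / 2) (by positivity))
    refine ⟨N, fun n hn => ?_⟩
    obtain ⟨c', hc'⟩ := hN n hn.le
    have h2 : ⨅ c, f n c ≤ f n c' := ciInf_le ⟨0, by rintro _ ⟨c, rfl⟩; exact hf n c⟩ c'
    have h3 : 0 ≤ ⨅ c, f n c := le_ciInf fun c => hf n c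
    rw [Real.dist_eq, sub_zero, abs_of_nonneg h3]
    linarith
  refine squeeze_zero (fun n => hf n _) (fun n => (hc n).le) ?_
  simpa using hinf.add tendsto_one_div_add_atTop_nhds_zero_nat

/-! ### Dependence of the signals on the sample point -/

namespace Code

section General

variable {V E ι : Type*} {P : CommProblem V E ι} {n : ℕ}

theorem signal_eq (c : Code P n) (ω : c.Sample) (e : E) (t : Fin n) :
    c.signal ω e t = c.encode e t (fun i => ω.1 i) (ω.2 (P.tail e))
      (fun e' s => c.signal ω e' ⟨s, s.isLt.trans t.isLt⟩) := by
  rw [signal]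

theorem signal_congr (c : Code P n) {ω ω' : c.Sample} {e : E}
    (hm : ∀ i, P.src i = P.tail e → ω.1 i = ω'.1 i)
    (hk : ω.2 (P.tail e) = ω'.2 (P.tail e))
    (hs : ∀ e', P.head e' = P.tail e → c.signal ω e' = c.signal ω' e') :
    c.signal ω e = c.signal ω' e := by
  funext t
  rw [signal_eq, signal_eq, hk]
  congr 1
  · funext i
    exact hm i i.2
  · funext e' s
    rw [hs e' e'.2]

theorem output_congr (c : Code P n) {ω ω' : c.Sample} {i : ι}
    (hm : ∀ j, P.src j = P.dst i → ω.1 j = ω'.1 j)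
    (hk : ω.2 (P.dst i) = ω'.2 (P.dst i))
    (hs : ∀ e', P.head e' = P.dst i → c.signal ω e' = c.signal ω' e') :
    c.output ω i = c.output ω' i := by
  rw [output, output, hk]
  congr 1
  · funext j
    exact hm j j.2
  · funext e' t
    rw [hs e' e'.2]

/-- On a set `A` of links that contains every link into the tail of one of its links, the signals
are determined by the messages and keys at the tails of the links of `A`. -/
theorem signal_congr_of_closed (c : Code P n) {ω ω' : c.Sample} (A : Set E)
    (hA : ∀ e ∈ A, ∀ e', P.head e' = P.tail e → e' ∈ A)
    (hm : ∀ e ∈ A, ∀ i, P.src i = P.tail e → ω.1 i = ω'.1 i)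
    (hk : ∀ e ∈ A, ω.2 (P.tail e) = ω'.2 (P.tail e)) {e : E} (he : e ∈ A) :
    c.signal ω e = c.signal ω' e := by
  have key : ∀ t : ℕ, ∀ ht : t < n, ∀ e ∈ A, c.signal ω e ⟨t, ht⟩ = c.signal ω' e ⟨t, ht⟩ := by
    intro t
    induction t using Nat.strong_induction_on with
    | _ t ih =>
      intro ht e he
      rw [signal_eq, signal_eq, hk e he]
      congr 1
      · funext i
        exact hm e he i i.2
      · funext e' s
        exact ih s s.2 _ e' (hA e he e' e'.2)
  funext t
  exact key t t.2 e he

theorem weight_nonneg [Fintype V] [Fintype ι] (c : Code P n) (ω : c.Sample) : 0 ≤ c.weight ω :=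
  mul_nonneg (Finset.prod_nonneg fun _ _ => by positivity)
    (Finset.prod_nonneg fun v _ => c.keyProb_nonneg v _)

theorem sum_inv_msgCard [Fintype ι] [DecidableEq ι] (c : Code P n) : ∑ _m : c.Msg, ∏ i, (c.msgCard i : ℝ)⁻¹ = 1 := by
  have h : ∏ i, (c.msgCard i : ℝ) ≠ 0 :=
    Finset.prod_ne_zero_iff.2 fun i _ => by exact_mod_cast (c.msgCard_pos i).ne'
  simp [Finset.prod_inv_distrib, h]

variable [Fintype V] [Fintype ι] [DecidableEq V] [DecidableEq ι]

theorem sum_weight (c : Code P n) : ∑ ω, c.weight ω = 1 := by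
  have h := sum_prod_weight (p := c.keyProb) c.keyProb_sum
  rw [Fintype.sum_prod_type, ← c.sum_inv_msgCard]
  refine Finset.sum_congr rfl fun m _ => ?_
  rw [← mul_one (∏ i, (c.msgCard i : ℝ)⁻¹), ← h, Finset.mul_sum]
  rfl

theorem entropy_eq (c : Code P n) {α : Type*} [Fintype α] (X : c.Sample → α) :
    c.entropy X = ent c.weight X / Real.log 2 := by
  rw [ent, Finset.sum_div]
  rfl

theorem leakage_singleton [DecidableEq E] (c : Code P n) (e : E) :
    c.leakage {e} = (ent c.weight (fun ω => ω.1) + ent c.weight (fun ω => c.signal ω e) -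
      ent c.weight (fun ω => (ω.1, c.signal ω e))) / Real.log 2 := by
  have h : ∀ ω ω', c.observed {e} ω = c.observed {e} ω' ↔ c.signal ω e = c.signal ω' e := by
    intro ω ω'
    constructor
    · intro h
      exact congrFun h ⟨e, Finset.mem_singleton_self e⟩
    · intro h
      funext e' t
      obtain ⟨e', he'⟩ := e'
      obtain rfl := Finset.mem_singleton.1 he'
      exact congrFun h t
  rw [leakage, mutualInfo, entropy_eq, entropy_eq, entropy_eq, ← add_div, ← sub_div,
    ent_congr c.weight_nonneg h,
    ent_congr (X := fun ω => (ω.1, c.observed {e} ω)) (Y := fun ω => (ω.1, c.signal ω e))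
      c.weight_nonneg (fun ω ω' => by simp only [Prod.mk.injEq, h])]

/-- The sample point with the messages of `ω`, its keys at the vertices in `s`, and the keys of `ω'`
elsewhere. -/
def mixKeys (c : Code P n) (s : V → Prop) [DecidablePred s] (ω ω' : c.Sample) : c.Sample :=
  (ω.1, fun v => if s v then ω.2 v else ω'.2 v)

/-- A random variable that depends only on the messages and on the keys in `s` is independent of
one that depends only on the other keys. -/
theorem law_pair_of_keys (c : Code P n) (s : V → Prop) [DecidablePred s] {α β : Type*}
    (X : c.Sample → α) (Y : c.Sample → β)
    (hX : ∀ ω ω', ω.1 = ω'.1 → (∀ v, s v → ω.2 v = ω'.2 v) → X ω = X ω')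
    (hY : ∀ ω ω', (∀ v, ¬s v → ω.2 v = ω'.2 v) → Y ω = Y ω') (a : α) (b : β) :
    law c.weight (fun ω => (X ω, Y ω)) (a, b) = law c.weight X a * law c.weight Y b := by
  refine law_pair_of_mix c.sum_weight (c.mixKeys s) ?_ ?_ X Y ?_ ?_ a b
  · intro ω ω'
    refine Prod.ext rfl (funext fun v => ?_)
    by_cases h : s v <;> simp [mixKeys, h]
  · intro ω ω'
    simp only [weight, mixKeys]
    rw [mul_mul_mul_comm]
    conv_rhs => rw [mul_mul_mul_comm]
    congr 1
    simp only [← Finset.prod_mul_distrib]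
    refine Finset.prod_congr rfl fun v _ => ?_
    by_cases h : s v <;> simp [h, mul_comm]
  · intro ω ω'
    exact hX _ _ rfl fun v hv => by simp [mixKeys, hv]
  · intro ω ω'
    exact hY _ _ fun v hv => by simp [mixKeys, hv]

theorem errorProb_nonneg (c : Code P n) (i : ι) : 0 ≤ c.errorProb i :=
  Finset.sum_nonneg fun ω _ => by split_ifs <;> simp [c.weight_nonneg]

theorem errorProb_le_one (c : Code P n) (i : ι) : c.errorProb i ≤ 1 := by
  rw [← c.sum_weight]
  exact Finset.sum_le_sum fun ω _ => by split_ifs <;> simp [c.weight_nonneg]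

end General

end Code

/-! ### The signals of the secure network -/

section SecureNetwork

variable {V E : Type*} {K n : ℕ} {N : CommProblem V E (Fin K)}

namespace Code

/-- The signals in the embedded network and from `Tᵢ` are determined by the keys of the embedded
network and of the vertices `Bⱼ`. -/
theorem signal_embedded_congr (c : Code (secureUnicast N) n) {ω ω' : c.Sample}
    (hB : ∀ i, ω.2 (.B i) = ω'.2 (.B i)) (hin : ∀ v, ω.2 (.inner v) = ω'.2 (.inner v))
    {e : SecureLink E K} (he : (∃ i, e = .d i) ∨ (∃ i, e = .b' i) ∨ ∃ e', e = .inner e') :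
    c.signal ω e = c.signal ω' e := by
  refine c.signal_congr_of_closed {e | (∃ i, e = .d i) ∨ (∃ i, e = .b' i) ∨ ∃ e', e = .inner e'}
    ?_ ?_ ?_ he
  · rintro e (⟨i, rfl⟩ | ⟨i, rfl⟩ | ⟨e, rfl⟩) e' <;> cases e' <;> simp [secureUnicast]
  · rintro e (⟨i, rfl⟩ | ⟨i, rfl⟩ | ⟨e, rfl⟩) <;> simp [secureUnicast]
  · rintro e (⟨i, rfl⟩ | ⟨i, rfl⟩ | ⟨e, rfl⟩) <;> simp [secureUnicast, hB, hin]

theorem signal_d_congr (c : Code (secureUnicast N) n) {ω ω' : c.Sample}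
    (hB : ∀ i, ω.2 (.B i) = ω'.2 (.B i)) (hin : ∀ v, ω.2 (.inner v) = ω'.2 (.inner v))
    (i : Fin K) : c.signal ω (.d i) = c.signal ω' (.d i) :=
  c.signal_embedded_congr hB hin (Or.inl ⟨i, rfl⟩)

theorem signal_inner_congr (c : Code (secureUnicast N) n) {ω ω' : c.Sample}
    (hB : ∀ i, ω.2 (.B i) = ω'.2 (.B i)) (hin : ∀ v, ω.2 (.inner v) = ω'.2 (.inner v))
    (e : E) : c.signal ω (.inner e) = c.signal ω' (.inner e) :=
  c.signal_embedded_congr hB hin (Or.inr (Or.inr ⟨e, rfl⟩))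

theorem signal_c_congr (c : Code (secureUnicast N) n) {ω ω' : c.Sample} {i : Fin K}
    (hM : ω.1 = ω'.1) (hS : ω.2 .S = ω'.2 .S) (hA : ω.2 (.A i) = ω'.2 (.A i))
    (hB : ω.2 (.B i) = ω'.2 (.B i)) : c.signal ω (.c i) = c.signal ω' (.c i) := by
  refine c.signal_congr_of_closed {e | e = .c i ∨ (∃ j, e = .a i j) ∨ e = .b i}
    ?_ ?_ ?_ (Or.inl rfl)
  · rintro e (rfl | ⟨j, rfl⟩ | rfl) e' h <;> cases e' <;> cases h
    · exact Or.inr (Or.inl ⟨_, rfl⟩)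
    · exact Or.inr (Or.inr rfl)
  · simp [hM]
  · rintro e (rfl | ⟨j, rfl⟩ | rfl) <;> simp [secureUnicast, hS, hA, hB]

theorem signal_f_congr (c : Code (secureUnicast N) n) {ω ω' : c.Sample} {i : Fin K}
    (hF : ω.2 (.F i) = ω'.2 (.F i)) : c.signal ω (.f i) = c.signal ω' (.f i) := by
  refine c.signal_congr (by simp [secureUnicast]) hF fun e' => ?_
  cases e' <;> simp [secureUnicast]

theorem signal_f'_congr (c : Code (secureUnicast N) n) {ω ω' : c.Sample} {i : Fin K}
    (hF : ω.2 (.F i) = ω'.2 (.F i)) : c.signal ω (.f' i) = c.signal ω' (.f' i) := by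
  refine c.signal_congr (by simp [secureUnicast]) hF fun e' => ?_
  cases e' <;> simp [secureUnicast]

theorem signal_e_congr (c : Code (secureUnicast N) n) {ω ω' : c.Sample} {i : Fin K}
    (hC : ω.2 (.C i) = ω'.2 (.C i)) (hF : ω.2 (.F i) = ω'.2 (.F i))
    (hc : c.signal ω (.c i) = c.signal ω' (.c i)) (hd : c.signal ω (.d i) = c.signal ω' (.d i)) :
    c.signal ω (.e i) = c.signal ω' (.e i) := by
  refine c.signal_congr (by simp [secureUnicast]) hC fun e' h => ?_
  cases e' <;> cases h
  exacts [hc, hd, c.signal_f'_congr hF]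

theorem output_congr_of_signal_e (c : Code (secureUnicast N) n) {ω ω' : c.Sample}
    (hD : ω.2 .D = ω'.2 .D) (hF : ∀ i, ω.2 (.F i) = ω'.2 (.F i))
    (he : ∀ i, c.signal ω (.e i) = c.signal ω' (.e i)) : c.output ω () = c.output ω' () := by
  refine c.output_congr (by simp [secureUnicast]) hD fun e' h => ?_
  cases e' <;> cases h
  exacts [he _, c.signal_f_congr (hF _)]

end Code

end SecureNetwork

/-! ### What a secure code transmits -/

section SecureCode

variable {V E : Type*} [Fintype V] [DecidableEq V] {K n : ℕ} {N : CommProblem V E (Fin K)}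

namespace Code

open Classical in
/-- The links `eᵢ` carry all information on the message that reaches the destination. -/
theorem one_sub_errorProb_mul_msgCard_le (c : Code (secureUnicast N) n) :
    (1 - c.errorProb ()) * c.msgCard () ≤ 2 ^ (n * K) := by
  have hM : (0 : ℝ) < c.msgCard () := by exact_mod_cast c.msgCard_pos ()
  have h1 : 1 - c.errorProb () = ∑ ω, if c.output ω () = ω.1 () then c.weight ω else 0 := by
    rw [← c.sum_weight, errorProb, prob, ← Finset.sum_sub_distrib]
    refine Finset.sum_congr rfl fun ω _ => ?_
    by_cases h : c.output ω () = ω.1 () <;> simp [h]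
  have h2 : ∀ κ : ∀ v, Fin (c.keyCard v),
      (∑ m : c.Msg, if c.output (m, κ) () = m () then c.weight (m, κ) else 0) ≤
        (∏ v, c.keyProb v (κ v)) * (2 ^ (n * K) / c.msgCard ()) := by
    intro κ
    have h3 : (Finset.univ.filter fun m : c.Msg => c.output (m, κ) () = m ()).card ≤
        2 ^ (n * K) := by
      have : Fintype.card (Fin K → Fin n → Bool) = 2 ^ (n * K) := by
        simp [pow_mul]
      rw [← this, ← Finset.card_univ]
      refine Finset.card_le_card_of_injOn (fun m j => c.signal (m, κ) (.e j))
        (fun _ _ => Finset.mem_univ _) ?_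
      intro m hm m' hm' h
      simp only [Finset.coe_filter, Finset.mem_univ, true_and, Set.mem_ofPred_eq] at hm hm'
      funext u
      rw [← hm, ← hm']
      exact c.output_congr_of_signal_e rfl (fun _ => rfl) fun j => congrFun h j
    have h4 : ∀ m : c.Msg, c.weight (m, κ) = (∏ v, c.keyProb v (κ v)) * (c.msgCard () : ℝ)⁻¹ := by
      intro m
      simp [weight, mul_comm]
    simp_rw [h4]
    rw [← Finset.sum_filter, Finset.sum_const, nsmul_eq_mul, mul_left_comm, ← div_eq_mul_inv]
    refine mul_le_mul_of_nonneg_left ?_ (Finset.prod_nonneg fun v _ => c.keyProb_nonneg _ _)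
    gcongr
    exact_mod_cast h3
  have h5 : 1 - c.errorProb () ≤ 2 ^ (n * K) / c.msgCard () := by
    rw [h1, Fintype.sum_prod_type, Finset.sum_comm]
    refine (Finset.sum_le_sum fun κ _ => h2 κ).trans_eq ?_
    rw [← Finset.sum_mul, sum_prod_weight (p := c.keyProb) c.keyProb_sum, one_mul]
  rwa [le_div_iff₀ hM] at h5

/-- A secure code makes `dᵢ` reproduce the key of `Bᵢ`: up to the loss in rate, the error
probability and the leakage on `cᵢ`, the conditional entropy of `dᵢ` given that key is the amount
by which the entropy of `dᵢ` exceeds `n` bits. -/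
theorem ent_d_given_key_le [DecidableEq E] (c : Code (secureUnicast N) n) (i : Fin K) :
    ent c.weight (fun ω => (ω.2 (.B i), c.signal ω (.d i))) - ent c.weight (fun ω => ω.2 (.B i)) ≤
      ent c.weight (fun ω => c.signal ω (.d i)) - n * Real.log 2 +
      (n * K * Real.log 2 - (1 - c.errorProb ()) * Real.log (c.msgCard ()) + Real.log 2 +
        c.leakage {.c i} * Real.log 2) := by
  have hw := c.weight_nonneg
  have hw1 := c.sum_weight
  have hlog : (0 : ℝ) < Real.log 2 := Real.log_pos one_lt_two
  let M : c.Sample → c.Msg := fun ω => ω.1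
  let C : c.Sample → Fin n → Bool := fun ω => c.signal ω (.c i)
  let D : c.Sample → Fin n → Bool := fun ω => c.signal ω (.d i)
  let T : c.Sample → {j : Fin K // j ≠ i} → Fin n → Bool := fun ω j => c.signal ω (.e j)
  let Z : c.Sample → (∀ j, Fin (c.keyCard (.F j))) × Fin (c.keyCard (.C i)) × Fin (c.keyCard .D) :=
    fun ω => (fun j => ω.2 (.F j), ω.2 (.C i), ω.2 .D)
  have hcardM : Real.log (Fintype.card c.Msg) = Real.log (c.msgCard ()) := by simp
  have hMunif : ent c.weight M = Real.log (c.msgCard ()) := by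
    have hlaw : ∀ m, law c.weight M m = (c.msgCard () : ℝ)⁻¹ := by
      intro m
      have h1 := sum_prod_weight (p := c.keyProb) c.keyProb_sum
      classical
      rw [law, Fintype.sum_prod_type, Finset.sum_eq_single m]
      · simp only [M, if_true, weight]
        rw [← Finset.mul_sum, h1]
        simp
      · intro m' _ hm'
        simp [M, hm']
      · simp
    have hc : (c.msgCard () : ℝ) ≠ 0 := by exact_mod_cast (c.msgCard_pos ()).ne'
    rw [ent_eq_sum]
    simp_rw [hlaw]
    rw [← Finset.sum_mul, hw1, Real.log_inv, neg_neg, one_mul]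
  have hfano := fano hw hw1 M (fun ω _ => c.output ω ())
    (fun ω => (T ω, (C ω, D ω), Z ω)) (by
      intro ω ω' h
      simp only [Prod.mk.injEq, Z, T, C, D] at h
      obtain ⟨hT, ⟨hC, hD⟩, hF, hkC, hkD⟩ := h
      funext _
      refine c.output_congr_of_signal_e hkD (fun j => congrFun hF j) fun j => ?_
      by_cases hj : j = i
      · subst hj
        exact c.signal_e_congr hkC (congrFun hF j) hC hD
      · exact congrFun hT ⟨j, hj⟩)
  replace hfano := hfano.trans_eq (b := _) (c := Real.log 2 + c.errorProb () *
    Real.log (c.msgCard ())) (by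
      rw [hcardM]
      congr 2
      refine Finset.sum_congr rfl fun ω _ => ?_
      have : (fun _ => c.output ω ()) ≠ M ω ↔ c.output ω () ≠ ω.1 () :=
        not_congr ⟨fun h => congrFun h (), fun h => funext fun _ => h⟩
      split_ifs <;> first | rfl | (exfalso; tauto))
  have hT : ent c.weight T ≤ n * (K - 1) * Real.log 2 := by
    refine (ent_le_log_card hw hw1 T).trans_eq ?_
    have hK : 1 ≤ K := i.pos
    simp [hK]
    ring
  have hD : ent c.weight D ≤ n * Real.log 2 := by
    refine (ent_le_log_card hw hw1 D).trans_eq ?_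
    simp
  have h1 := ent_pair_le hw hw1 T fun ω => ((C ω, D ω), Z ω)
  have h2 := ent_pair_le hw hw1 (fun ω => (C ω, D ω)) Z
  have h3 := ent_pair_le hw hw1 C D
  have h4 : ent c.weight (fun ω => ((M ω, C ω, D ω), Z ω)) ≤
      ent c.weight (fun ω => (M ω, T ω, (C ω, D ω), Z ω)) :=
    ent_mono hw fun ω ω' h => by
      simp only [Prod.mk.injEq] at h ⊢
      tauto
  -- the keys of `C i`, `D` and the `F j` do not influence the signals on `c i` and `d i`
  have h5 : ent c.weight (fun ω => ((M ω, C ω, D ω), Z ω)) =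
      ent c.weight (fun ω => (M ω, C ω, D ω)) + ent c.weight Z := by
    refine ent_pair_of_indep hw _ _ (c.law_pair_of_keys
      (fun v => (∀ j, v ≠ .F j) ∧ v ≠ .C i ∧ v ≠ .D) _ _ ?_ ?_)
    · intro ω ω' hm hk
      simp only [M, C, D, Prod.mk.injEq]
      exact ⟨hm, c.signal_c_congr hm (hk _ (by simp)) (hk _ (by simp)) (hk _ (by simp)),
        c.signal_d_congr (fun j => hk _ (by simp)) (fun j => hk _ (by simp)) i⟩
    · intro ω ω' hk
      simp only [Z, Prod.mk.injEq]
      exact ⟨funext fun j => hk _ (by simp), hk _ (by simp), hk _ (by simp)⟩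
  have hleak : c.leakage {.c i} * Real.log 2 =
      ent c.weight M + ent c.weight C - ent c.weight (fun ω => (M ω, C ω)) := by
    rw [leakage_singleton, div_mul_cancel₀ _ hlog.ne']
  -- given the key of `B i`, the signal on `d i` is independent of what else determines `c i`
  let Q : c.Sample → c.Msg × Fin (c.keyCard .S) × Fin (c.keyCard (.A i)) :=
    fun ω => (ω.1, ω.2 .S, ω.2 (.A i))
  let B : c.Sample → Fin (c.keyCard (.B i)) := fun ω => ω.2 (.B i)
  have h6 : ent c.weight (fun ω => ((Q ω, B ω), D ω)) - ent c.weight (fun ω => (Q ω, B ω)) ≤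
      ent c.weight (fun ω => ((M ω, C ω), D ω)) - ent c.weight (fun ω => (M ω, C ω)) := by
    refine ent_cond_le hw D fun ω ω' h => ?_
    simp only [Q, B, Prod.mk.injEq] at h
    obtain ⟨⟨hm, hS, hA⟩, hB⟩ := h
    simp only [M, C, Prod.mk.injEq]
    exact ⟨hm, c.signal_c_congr hm hS hA hB⟩
  have hindep : ∀ {α : Type _} [Fintype α] (Y : c.Sample → α),
      (∀ ω ω' : c.Sample, (∀ v, v ≠ .S → v ≠ .A i → ω.2 v = ω'.2 v) → Y ω = Y ω') →
      ent c.weight (fun ω => (Q ω, Y ω)) = ent c.weight Q + ent c.weight Y := by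
    intro α _ Y hY
    refine ent_pair_of_indep hw _ _ (c.law_pair_of_keys (fun v => v = .S ∨ v = .A i) _ _ ?_ ?_)
    · intro ω ω' hm hk
      simp only [Q, Prod.mk.injEq]
      exact ⟨hm, hk _ (by simp), hk _ (by simp)⟩
    · intro ω ω' hk
      exact hY _ _ fun v h1 h2 => hk v (by simp [h1, h2])
  have h7 := hindep B fun ω ω' hk => hk _ (by simp) (by simp)
  have h8 := hindep (fun ω => (B ω, D ω)) fun ω ω' hk => by
    simp only [B, D, Prod.mk.injEq]
    exact ⟨hk _ (by simp) (by simp),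
      c.signal_d_congr (fun j => hk _ (by simp) (by simp)) (fun v => hk _ (by simp) (by simp)) i⟩
  have h9 : ent c.weight (fun ω => (Q ω, (B ω, D ω))) =
      ent c.weight (fun ω => ((Q ω, B ω), D ω)) :=
    ent_congr hw fun ω ω' => by simp only [Prod.mk.injEq]; tauto
  have h10 : ent c.weight (fun ω => (M ω, C ω, D ω)) =
      ent c.weight (fun ω => ((M ω, C ω), D ω)) :=
    ent_congr hw fun ω ω' => by simp only [Prod.mk.injEq]; tauto
  change ent c.weight (fun ω => (B ω, D ω)) - ent c.weight B ≤ ent c.weight D - _ + _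
  linarith

end Code

end SecureCode

/-! ### From a secure code to a code for the embedded network -/

section RandomCoding

variable {V E : Type*} {K n : ℕ} {N : CommProblem V E (Fin K)}

namespace Code

/-- The sample point `ω` with the keys of the vertices `Bᵢ` replaced by `x`. -/
def splice (c : Code (secureUnicast N) n) (ω : c.Sample)
    (x : ∀ i, Fin (c.keyCard (.B i))) : c.Sample :=
  (ω.1, fun
    | .B i => x i
    | .S => ω.2 .S
    | .D => ω.2 .D
    | .A i => ω.2 (.A i)
    | .C i => ω.2 (.C i)
    | .F i => ω.2 (.F i)
    | .inner v => ω.2 (.inner v))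

theorem signal_b'_congr (c : Code (secureUnicast N) n) {ω ω' : c.Sample} {i : Fin K}
    (hB : ω.2 (.B i) = ω'.2 (.B i)) : c.signal ω (.b' i) = c.signal ω' (.b' i) := by
  refine c.signal_congr (by simp [secureUnicast]) hB fun e' => ?_
  cases e' <;> simp [secureUnicast]

/-- A codebook: for each `i`, the message `w` is represented by the key `cb (i, w)` of `Bᵢ`. -/
abbrev Codebook (c : Code (secureUnicast N) n) (W : ℕ) : Type :=
  ∀ j : Fin K × Fin W, Fin (c.keyCard (.B j.1))

/-- The bits that an embedded vertex `v` would have received by time `t` in the secure network,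
reconstructed from the bits received in the embedded network and from the messages at `v`, which
select the keys of the vertices `Bᵢ` adjacent to `v`. -/
def simInput [DecidableEq V] (c : Code (secureUnicast N) n) {W : ℕ} (ω₀ : c.Sample)
    (cb : c.Codebook W) (v : V) (msgs : {i // N.src i = v} → Fin W) {t : ℕ} (ht : t ≤ n)
    (hist : {e // N.head e = v} → Fin t → Bool) :
    {e // (secureUnicast N).head e = .inner v} → Fin t → Bool
  | ⟨.inner e, h⟩, s => hist ⟨e, SecureNode.inner.inj h⟩ s
  | ⟨e, _⟩, s => c.signal (c.splice ω₀ fun i =>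
      if h : N.src i = v then cb (i, msgs ⟨i, h⟩) else ω₀.2 (.B i)) e ⟨s, s.2.trans_le ht⟩

/-- The code for the embedded network that simulates the secure code `c`, with the keys of the
embedded vertices fixed as in `ω₀` and the keys of the vertices `Bᵢ` taken from a codebook. The
destinations apply `dec` to the signal on `dᵢ`. -/
def simulation [DecidableEq V] (c : Code (secureUnicast N) n) {W : ℕ} (hW : 0 < W)
    (ω₀ : c.Sample) (cb : c.Codebook W) (dec : Fin K → (Fin n → Bool) → Fin W) : Code N n where
  msgCard _ := W
  msgCard_pos _ := hW
  keyCard _ := 1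
  keyProb _ _ := 1
  keyProb_nonneg _ _ := zero_le_one
  keyProb_sum _ := by simp
  encode e t msgs _ hist := c.encode (.inner e) t (fun i => ω₀.1 i) (ω₀.2 (.inner (N.tail e)))
    (c.simInput ω₀ cb (N.tail e) msgs t.2.le hist)
  decode i msgs _ hist := dec i fun t => c.encode (.d i) t (fun i => ω₀.1 i)
    (ω₀.2 (.inner (N.dst i)))
    (c.simInput ω₀ cb (N.dst i) msgs t.2.le fun e s => hist e ⟨s, s.2.trans t.2⟩)

theorem simInput_eq [DecidableEq V] (c : Code (secureUnicast N) n) {W : ℕ} (ω₀ : c.Sample)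
    (cb : c.Codebook W) (v : V) (w : Fin K → Fin W) {t : ℕ} (ht : t ≤ n)
    (hist : {e // N.head e = v} → Fin t → Bool)
    (hhist : ∀ e (s : Fin t), hist e s =
      c.signal (c.splice ω₀ fun i => cb (i, w i)) (.inner e) ⟨s, s.2.trans_le ht⟩) :
    c.simInput ω₀ cb v (fun i => w i) ht hist =
      fun e (s : Fin t) => c.signal (c.splice ω₀ fun i => cb (i, w i)) e.1 ⟨s, s.2.trans_le ht⟩ := by
  funext ⟨e, he⟩ s
  cases e with
  | inner e => exact hhist ⟨e, SecureNode.inner.inj he⟩ s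
  | b' i =>
    have hi : N.src i = v := SecureNode.inner.inj he
    refine congrFun (c.signal_b'_congr ?_) _
    simp [splice, hi]
  | a | b | c | d | e | f | f' => cases he

theorem signal_simulation [DecidableEq V] (c : Code (secureUnicast N) n) {W : ℕ} (hW : 0 < W)
    (ω₀ : c.Sample) (cb : c.Codebook W) (dec : Fin K → (Fin n → Bool) → Fin W)
    (ω : (c.simulation hW ω₀ cb dec).Sample) (t : ℕ) (ht : t < n) (e : E) :
    (c.simulation hW ω₀ cb dec).signal ω e ⟨t, ht⟩ =
      c.signal (c.splice ω₀ fun i => cb (i, ω.1 i)) (.inner e) ⟨t, ht⟩ := by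
  induction t using Nat.strong_induction_on generalizing e with
  | _ t ih =>
    rw [signal_eq, signal_eq]
    change c.encode (.inner e) _ (fun i => ω₀.1 i) (ω₀.2 (.inner (N.tail e)))
      (c.simInput ω₀ cb (N.tail e) (fun i => ω.1 i) ht.le _) = _
    rw [c.simInput_eq ω₀ cb (N.tail e) ω.1 ht.le _ fun e' s => ih s s.2 _ e']
    rfl

theorem output_simulation [DecidableEq V] (c : Code (secureUnicast N) n) {W : ℕ} (hW : 0 < W)
    (ω₀ : c.Sample) (cb : c.Codebook W) (dec : Fin K → (Fin n → Bool) → Fin W)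
    (ω : (c.simulation hW ω₀ cb dec).Sample) (i : Fin K) :
    (c.simulation hW ω₀ cb dec).output ω i =
      dec i (c.signal (c.splice ω₀ fun i => cb (i, ω.1 i)) (.d i)) := by
  change dec i _ = dec i _
  congr 1
  funext t
  rw [signal_eq]
  change c.encode (.d i) _ (fun i => ω₀.1 i) (ω₀.2 (.inner (N.dst i)))
    (c.simInput ω₀ cb (N.dst i) (fun i => ω.1 i) t.2.le _) = _
  rw [c.simInput_eq ω₀ cb (N.dst i) ω.1 t.2.le _ fun e' s =>
    c.signal_simulation hW ω₀ cb dec ω s _ e']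
  rfl

open Classical in
theorem errorProb_simulation [Fintype V] [DecidableEq V] (c : Code (secureUnicast N) n) {W : ℕ}
    (hW : 0 < W) (ω₀ : c.Sample) (cb : c.Codebook W) (dec : Fin K → (Fin n → Bool) → Fin W)
    (i : Fin K) :
    (c.simulation hW ω₀ cb dec).errorProb i = ∑ w : Fin K → Fin W, ((W : ℝ) ^ K)⁻¹ *
      if dec i (c.signal (c.splice ω₀ fun i => cb (i, w i)) (.d i)) ≠ w i then 1 else 0 := by
  rw [errorProb, prob, Fintype.sum_prod_type]
  refine Finset.sum_congr rfl fun w _ => ?_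
  have : Unique (∀ v, Fin ((c.simulation hW ω₀ cb dec).keyCard v)) :=
    inferInstanceAs (Unique (V → Fin 1))
  rw [Fintype.sum_unique, output_simulation]
  simp [weight, simulation]

end Code

end RandomCoding

/-! ### The random coding argument -/

section Averaging

theorem prod_eq_prod_mul_prod_compl_range {J I : Type*} [Fintype J] [Fintype I] [DecidableEq J]
    {f : I → J} (hf : Function.Injective f) (g : J → ℝ) :
    ∏ j, g j = (∏ i, g (f i)) * ∏ j ∈ (Finset.univ.image f)ᶜ, g j := by
  rw [← Finset.prod_mul_prod_compl (Finset.univ.image f), Finset.prod_image fun _ _ _ _ h => hf h]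

variable {V E : Type*} {K n : ℕ} {N : CommProblem V E (Fin K)}

namespace Code

/-- The probability of a sample point together with a codebook of independent keys. -/
noncomputable def codebookWeight [Fintype V] (c : Code (secureUnicast N) n) {W : ℕ}
    (z : c.Sample × c.Codebook W) : ℝ :=
  c.weight z.1 * ∏ j : Fin K × Fin W, c.keyProb (.B j.1) (z.2 j)

theorem codebookWeight_nonneg [Fintype V] (c : Code (secureUnicast N) n) {W : ℕ}
    (z : c.Sample × c.Codebook W) : 0 ≤ c.codebookWeight z :=
  mul_nonneg (c.weight_nonneg _) (Finset.prod_nonneg fun _ _ => c.keyProb_nonneg _ _)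

/-- The keys of the vertices `Bᵢ` are exchanged with the codewords of the messages `w i`. -/
def swapCodeword (c : Code (secureUnicast N) n) {W : ℕ} (w : Fin K → Fin W)
    (z : c.Sample × c.Codebook W) : c.Sample × c.Codebook W :=
  (c.splice z.1 fun i => z.2 (i, w i), fun j => if j.2 = w j.1 then z.1.2 (.B j.1) else z.2 j)

theorem swapCodeword_involutive (c : Code (secureUnicast N) n) {W : ℕ} (w : Fin K → Fin W) :
    Function.Involutive (c.swapCodeword w) := by
  rintro ⟨ω, cb⟩
  refine Prod.ext (Prod.ext rfl (funext fun v => ?_)) (funext fun j => ?_)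
  · cases v <;> simp [swapCodeword, splice]
  · obtain ⟨i, u⟩ := j
    by_cases h : u = w i
    · subst h
      simp [swapCodeword, splice]
    · simp [swapCodeword, h]

variable [Fintype V] [DecidableEq V]

theorem sum_codebookWeight_mul_left (c : Code (secureUnicast N) n) {W : ℕ} (f : c.Sample → ℝ) :
    ∑ z : c.Sample × c.Codebook W, c.codebookWeight z * f z.1 = ∑ ω, c.weight ω * f ω := by
  rw [Fintype.sum_prod_type]
  refine Finset.sum_congr rfl fun ω _ => ?_
  have h := sum_prod_weight (p := fun j : Fin K × Fin W => c.keyProb (.B j.1))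
    fun j => c.keyProb_sum _
  simp only [codebookWeight]
  rw [← Finset.sum_mul, ← Finset.mul_sum, h, mul_one]

theorem sum_codebookWeight (c : Code (secureUnicast N) n) {W : ℕ} :
    ∑ z : c.Sample × c.Codebook W, c.codebookWeight z = 1 := by
  simpa [c.sum_weight] using c.sum_codebookWeight_mul_left (W := W) fun _ => 1

theorem sum_codebookWeight_mul (c : Code (secureUnicast N) n) {W : ℕ} (j : Fin K × Fin W)
    (f : c.Sample → Fin (c.keyCard (.B j.1)) → ℝ) :
    ∑ z : c.Sample × c.Codebook W, c.codebookWeight z * f z.1 (z.2 j) =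
      ∑ ω, ∑ x, c.weight ω * c.keyProb (.B j.1) x * f ω x := by
  rw [Fintype.sum_prod_type]
  refine Finset.sum_congr rfl fun ω _ => ?_
  have h := sum_prod_weight_mul (p := fun j : Fin K × Fin W => c.keyProb (.B j.1))
    (fun j => c.keyProb_sum _) j (f ω)
  simp only [codebookWeight, mul_assoc]
  rw [← Finset.mul_sum, h, Finset.mul_sum]

theorem codebookWeight_swapCodeword (c : Code (secureUnicast N) n) {W : ℕ} (w : Fin K → Fin W)
    (z : c.Sample × c.Codebook W) :
    c.codebookWeight (c.swapCodeword w z) = c.codebookWeight z := by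
  obtain ⟨ω, cb⟩ := z
  have hB : Function.Injective (SecureNode.B : Fin K → SecureNode V K) :=
    fun _ _ h => SecureNode.B.inj h
  have hw : Function.Injective (fun i => (i, w i)) := fun _ _ h => (Prod.mk.inj h).1
  simp only [codebookWeight, weight]
  rw [prod_eq_prod_mul_prod_compl_range hB, prod_eq_prod_mul_prod_compl_range hB,
    prod_eq_prod_mul_prod_compl_range hw, prod_eq_prod_mul_prod_compl_range hw]
  have h1 : ∏ v ∈ (Finset.univ.image (SecureNode.B : Fin K → SecureNode V K))ᶜ,
      c.keyProb v ((c.swapCodeword w (ω, cb)).1.2 v) =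
      ∏ v ∈ (Finset.univ.image (SecureNode.B : Fin K → SecureNode V K))ᶜ,
      c.keyProb v (ω.2 v) := by
    refine Finset.prod_congr rfl fun v hv => ?_
    cases v <;> simp [swapCodeword, splice] at hv ⊢
  have h2 : ∏ j ∈ (Finset.univ.image fun i => (i, w i))ᶜ,
      c.keyProb (.B j.1) ((c.swapCodeword w (ω, cb)).2 j) =
      ∏ j ∈ (Finset.univ.image fun i => (i, w i))ᶜ, c.keyProb (.B j.1) (cb j) := by
    refine Finset.prod_congr rfl fun j hj => ?_
    have : j.2 ≠ w j.1 := by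
      rintro h
      simp only [Finset.mem_compl, Finset.mem_image, Finset.mem_univ, true_and, not_exists] at hj
      exact hj j.1 (Prod.ext rfl h.symm)
    simp [swapCodeword, this]
  rw [h1, h2]
  simp only [swapCodeword, splice, if_true]
  ring

/-- The sample point that a message tuple `w` selects from a random codebook has the distribution
of the secure code, independently of the codewords of the other messages. -/
theorem sum_codebookWeight_mul_splice (c : Code (secureUnicast N) n) {W : ℕ} (w : Fin K → Fin W)
    (f : c.Sample → c.Codebook W → ℝ)
    (hf : ∀ ω cb cb', (∀ j, j.2 ≠ w j.1 → cb j = cb' j) → f ω cb = f ω cb') :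
    ∑ z, c.codebookWeight z * f (c.splice z.1 fun i => z.2 (i, w i)) z.2 =
      ∑ z, c.codebookWeight z * f z.1 z.2 := by
  rw [← Equiv.sum_comp (c.swapCodeword_involutive w).toPerm fun z => c.codebookWeight z * f z.1 z.2]
  refine Finset.sum_congr rfl fun z _ => ?_
  simp only [Function.Involutive.coe_toPerm, codebookWeight_swapCodeword]
  congr 1
  refine hf _ _ _ fun j hj => ?_
  simp [swapCodeword, hj]

theorem sum_weight_mul_key (c : Code (secureUnicast N) n) (v : SecureNode V K)
    (f : Fin (c.keyCard v) → ℝ) :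
    ∑ ω, c.weight ω * f (ω.2 v) = ∑ x, c.keyProb v x * f x := by
  rw [Fintype.sum_prod_type, ← sum_prod_weight_mul (p := c.keyProb) c.keyProb_sum v f]
  have h : ∀ m : c.Msg, ∑ κ : ∀ v, Fin (c.keyCard v), c.weight (m, κ) * f (κ v) =
      (∏ i, (c.msgCard i : ℝ)⁻¹) *
        ∑ κ : ∀ v, Fin (c.keyCard v), (∏ v, c.keyProb v (κ v)) * f (κ v) := by
    intro m
    rw [Finset.mul_sum]
    exact Finset.sum_congr rfl fun κ _ => mul_assoc _ _ _
  refine (Finset.sum_congr rfl fun m _ => h m).trans ?_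
  rw [← Finset.sum_mul, c.sum_inv_msgCard, one_mul]

theorem law_key (c : Code (secureUnicast N) n) (v : SecureNode V K) (x : Fin (c.keyCard v)) :
    law c.weight (fun ω => ω.2 v) x = c.keyProb v x := by
  classical
  have h := c.sum_weight_mul_key v fun y => if y = x then 1 else 0
  simp only [mul_ite, mul_one, mul_zero, Finset.sum_ite_eq', Finset.mem_univ, if_true] at h
  rw [← h, law]
  refine Finset.sum_congr rfl fun ω _ => ?_
  split_ifs <;> rfl

open Classical in
/-- The message whose codeword is plausible for the signal on `dᵢ`, if there is only one. -/
noncomputable def thresholdDecoder (c : Code (secureUnicast N) n) {W : ℕ} (hW : 0 < W) (τ : ℝ)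
    (cb : c.Codebook W) (i : Fin K) (y : Fin n → Bool) : Fin W :=
  if h : ∃ u, ∀ u', Plausible c.weight (fun ω => ω.2 (.B i)) (fun ω => c.signal ω (.d i)) τ
    (cb (i, u')) y ↔ u' = u then h.choose else ⟨0, hW⟩

theorem thresholdDecoder_eq (c : Code (secureUnicast N) n) {W : ℕ} (hW : 0 < W) {τ : ℝ}
    {cb : c.Codebook W} {i : Fin K} {y : Fin n → Bool} {u : Fin W}
    (h : ∀ u', Plausible c.weight (fun ω => ω.2 (.B i)) (fun ω => c.signal ω (.d i)) τ
      (cb (i, u')) y ↔ u' = u) : c.thresholdDecoder hW τ cb i y = u := by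
  have hex : ∃ u, ∀ u', Plausible c.weight (fun ω => ω.2 (.B i)) (fun ω => c.signal ω (.d i)) τ
    (cb (i, u')) y ↔ u' = u := ⟨u, h⟩
  rw [thresholdDecoder, dif_pos hex]
  exact ((hex.choose_spec _).1 ((h u).2 rfl)).symm

open Classical in
/-- The random coding bound on the error probability of the `i`-th message. -/
theorem average_error_le (c : Code (secureUnicast N) n) {W : ℕ} (hW : 0 < W) {s τ : ℝ}
    (hs : 0 ≤ s) (hτ : 0 < τ) (i : Fin K) (w : Fin K → Fin W) :
    (∑ z : c.Sample × c.Codebook W, c.codebookWeight z *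
      if c.thresholdDecoder hW τ z.2 i (c.signal (c.splice z.1 fun i => z.2 (i, w i)) (.d i)) ≠ w i
        then 1 else 0) ≤
      (∑ ω, if ¬Plausible c.weight (fun ω => ω.2 (.B i)) (fun ω => c.signal ω (.d i)) τ
        (ω.2 (.B i)) (c.signal ω (.d i)) then c.weight ω else 0) +
      (∑ ω, if s < law c.weight (fun ω => c.signal ω (.d i)) (c.signal ω (.d i))
        then c.weight ω else 0) + W * (s / τ) := by
  set X : c.Sample → Fin (c.keyCard (.B i)) := fun ω => ω.2 (.B i) with hX
  set Y : c.Sample → Fin n → Bool := fun ω => c.signal ω (.d i)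
  let f₁ : c.Sample → ℝ := fun ω => (if ¬Plausible c.weight X Y τ (X ω) (Y ω) then 1 else 0) +
    if s < law c.weight Y (Y ω) then 1 else 0
  let f₂ : c.Sample → Fin (c.keyCard (.B i)) → ℝ := fun ω x =>
    if law c.weight Y (Y ω) ≤ s ∧ Plausible c.weight X Y τ x (Y ω) then 1 else 0
  let f : c.Sample → c.Codebook W → ℝ := fun ω cb =>
    f₁ ω + ∑ u ∈ Finset.univ.erase (w i), f₂ ω (cb (i, u))
  have hf₂ : ∀ ω x, 0 ≤ f₂ ω x := fun ω x => by positivity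
  have hf : ∀ ω cb cb', (∀ j, j.2 ≠ w j.1 → cb j = cb' j) → f ω cb = f ω cb' := by
    intro ω cb cb' h
    simp only [f]
    congr 1
    refine Finset.sum_congr rfl fun u hu => ?_
    rw [h (i, u) (Finset.ne_of_mem_erase hu)]
  -- the decoder can only fail if the true codeword is implausible, if the output is too likely, or
  -- if another codeword is plausible
  have hle : ∀ z : c.Sample × c.Codebook W, (if c.thresholdDecoder hW τ z.2 i
      (c.signal (c.splice z.1 fun i => z.2 (i, w i)) (.d i)) ≠ w i then (1 : ℝ) else 0) ≤
      f (c.splice z.1 fun i => z.2 (i, w i)) z.2 := by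
    intro z
    set ω := c.splice z.1 fun i => z.2 (i, w i)
    have hsum : 0 ≤ ∑ u ∈ Finset.univ.erase (w i), f₂ ω (z.2 (i, u)) :=
      Finset.sum_nonneg fun u _ => hf₂ _ _
    by_cases h1 : Plausible c.weight X Y τ (X ω) (Y ω)
    · by_cases h2 : s < law c.weight Y (Y ω)
      · have : (1 : ℝ) ≤ f ω z.2 := by
          simp only [f, f₁, h1, h2, if_true, not_true, if_false]
          linarith
        refine le_trans ?_ this
        split_ifs <;> norm_num
      · split_ifs with h3
        · by_contra hlt
          refine h3 (c.thresholdDecoder_eq hW fun u => ⟨fun hu => ?_, fun hu => ?_⟩)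
          · by_contra hne
            refine hlt ?_
            have : f₂ ω (z.2 (i, u)) ≤ ∑ u ∈ Finset.univ.erase (w i), f₂ ω (z.2 (i, u)) :=
              Finset.single_le_sum (f := fun u => f₂ ω (z.2 (i, u))) (fun u _ => hf₂ _ _)
                (Finset.mem_erase.2 ⟨hne, Finset.mem_univ _⟩)
            have h4 : f₂ ω (z.2 (i, u)) = 1 := if_pos ⟨not_lt.1 h2, hu⟩
            simp only [f, f₁, h1, h2, not_true, if_false]
            linarith
          · rw [hu]
            exact h1
        · simp only [f, f₁]
          positivity
    · have : (1 : ℝ) ≤ f ω z.2 := by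
        simp only [f, f₁, h1, not_false_eq_true, if_true]
        split_ifs <;> linarith
      refine le_trans ?_ this
      split_ifs <;> norm_num
  calc _ ≤ ∑ z : c.Sample × c.Codebook W,
        c.codebookWeight z * f (c.splice z.1 fun i => z.2 (i, w i)) z.2 :=
        Finset.sum_le_sum fun z _ => mul_le_mul_of_nonneg_left (hle z) (c.codebookWeight_nonneg z)
    _ = ∑ z : c.Sample × c.Codebook W, c.codebookWeight z * f z.1 z.2 :=
        c.sum_codebookWeight_mul_splice w f hf
    _ = ∑ ω, c.weight ω * f₁ ω + ∑ u ∈ Finset.univ.erase (w i),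
        ∑ ω, ∑ x, c.weight ω * c.keyProb (.B i) x * f₂ ω x := by
        simp only [f, mul_add, Finset.sum_add_distrib, Finset.mul_sum]
        rw [c.sum_codebookWeight_mul_left, Finset.sum_comm]
        congr 1
        exact Finset.sum_congr rfl fun u _ => c.sum_codebookWeight_mul (i, u) f₂
    _ ≤ _ := by
        refine add_le_add ?_ ?_
        · refine le_of_eq ?_
          simp only [f₁, mul_add, Finset.sum_add_distrib, mul_ite, mul_one, mul_zero]
          rfl
        · have h5 := prob_plausible_indep_le c.weight_nonneg c.sum_weight X Y hs hτ
          have h6 : (∑ ω, ∑ x, c.weight ω * c.keyProb (.B i) x * f₂ ω x) ≤ s / τ := by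
            refine le_trans (le_of_eq ?_) h5
            refine Finset.sum_congr rfl fun ω _ => Finset.sum_congr rfl fun x _ => ?_
            rw [hX, c.law_key (.B i) x]
            simp [f₂, hX]
          refine (Finset.sum_le_sum fun u _ => h6).trans ?_
          rw [Finset.sum_const, nsmul_eq_mul]
          refine mul_le_mul_of_nonneg_right ?_ (by positivity)
          exact_mod_cast (Finset.card_le_univ _).trans_eq (Fintype.card_fin W)

open Classical in
/-- Some codebook performs at least as well as the random one. -/
theorem exists_code_of_secure_code (c : Code (secureUnicast N) n) {W : ℕ} (hW : 0 < W) {s τ : ℝ}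
    (hs : 0 ≤ s) (hτ : 0 < τ) :
    ∃ c' : Code N n, (∀ i, c'.msgCard i = W) ∧ ∑ i, c'.errorProb i ≤
      ∑ i, ((∑ ω, if ¬Plausible c.weight (fun ω => ω.2 (.B i)) (fun ω => c.signal ω (.d i)) τ
        (ω.2 (.B i)) (c.signal ω (.d i)) then c.weight ω else 0) +
      (∑ ω, if s < law c.weight (fun ω => c.signal ω (.d i)) (c.signal ω (.d i))
        then c.weight ω else 0) + W * (s / τ)) := by
  have hWK : (0 : ℝ) < (W : ℝ) ^ K := by positivity
  obtain ⟨z, hz⟩ := exists_le_of_sum_le (p := c.codebookWeight (W := W))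
    (f := fun z => ∑ i, (c.simulation hW z.1 z.2 (c.thresholdDecoder hW τ z.2)).errorProb i)
    c.codebookWeight_nonneg c.sum_codebookWeight (b := ∑ i,
      ((∑ ω, if ¬Plausible c.weight (fun ω => ω.2 (.B i)) (fun ω => c.signal ω (.d i)) τ
        (ω.2 (.B i)) (c.signal ω (.d i)) then c.weight ω else 0) +
      (∑ ω, if s < law c.weight (fun ω => c.signal ω (.d i)) (c.signal ω (.d i))
        then c.weight ω else 0) + W * (s / τ))) (by
      simp_rw [errorProb_simulation, Finset.mul_sum]
      rw [Finset.sum_comm]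
      refine Finset.sum_le_sum fun i _ => ?_
      rw [Finset.sum_comm]
      simp_rw [mul_left_comm (c.codebookWeight _), ← Finset.mul_sum]
      rw [inv_mul_le_iff₀ hWK]
      refine (Finset.sum_le_sum fun w _ => c.average_error_le hW hs hτ i w).trans_eq ?_
      simp only [Finset.sum_const, Finset.card_univ, Fintype.card_fun, Fintype.card_fin,
        nsmul_eq_mul, Nat.cast_pow])
  exact ⟨_, fun _ => rfl, hz⟩

end Code

end Averaging

/-! ### Asymptotics of the converse and of the upper bound -/

section Converse

variable {V E : Type*} {K n : ℕ} {N : CommProblem V E (Fin K)}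

theorem Code.rate_eq_of_msgCard {ι : Type*} {P : CommProblem V E ι} (c : Code P n) {i : ι} {k : ℕ}
    (h : c.msgCard i = 2 ^ k) : c.rate i = k / n := by
  rw [rate, h, Nat.cast_pow, Real.logb_pow]
  simp

theorem Code.log_msgCard_eq {ι : Type*} {P : CommProblem V E ι} (c : Code P n) (i : ι) (hn : 0 < n) :
    Real.log (c.msgCard i) = c.rate i * (n * Real.log 2) := by
  have h1 : (n : ℝ) ≠ 0 := by exact_mod_cast hn.ne'
  have h2 : Real.log 2 ≠ 0 := (Real.log_pos one_lt_two).ne'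
  rw [Code.rate, Real.logb]
  field_simp

variable [Fintype V] [DecidableEq V]

theorem ent_nonneg_cond {Ω α β : Type*} [Fintype Ω] [Fintype α] [Fintype β] {p : Ω → ℝ}
    (hp : ∀ ω, 0 ≤ p ω) (X : Ω → α) (Y : Ω → β) :
    0 ≤ ent p (fun ω => (X ω, Y ω)) - ent p X :=
  sub_nonneg.2 (ent_mono hp fun _ _ h => (Prod.mk.inj h).1)

/-- A secure code whose rate deficit, error probability and leakage amount to at most `ρ ^ 2` bits
per time slot yields a code for the embedded network with defect of order `ρ`. -/
theorem Code.exists_code_of_deficit_le [DecidableEq E] (c : Code (secureUnicast N) n) {ρ : ℝ}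
    (hρ : 0 < ρ) (hρ' : ρ ≤ 1 / 3)
    (hβ : ∀ i, n * K * Real.log 2 - (1 - c.errorProb ()) * Real.log (c.msgCard ()) + Real.log 2 +
      c.leakage {.c i} * Real.log 2 ≤ ρ ^ 2 * (n * Real.log 2))
    (hn : 1 ≤ ρ ^ 2 * (n * Real.log 2)) (hn' : (2 : ℝ) ^ (-(ρ * n)) ≤ ρ) :
    ∃ c' : Code N n, ∑ i, (|c'.rate i - 1| + c'.errorProb i) ≤ 8 * K * ρ := by
  have hlog : (0 : ℝ) < Real.log 2 := Real.log_pos one_lt_two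
  have hlog1 : Real.log 2 < 1 := Real.log_two_lt_d9.trans (by norm_num)
  have hn0 : (0 : ℝ) < n := by
    rcases Nat.eq_zero_or_pos n with h | h
    · simp [h] at hn
      linarith
    · exact_mod_cast h
  have hnl : 0 < n * Real.log 2 := mul_pos hn0 hlog
  -- the union bound over `2 ^ k` codewords costs `k` bits, the thresholds `s` and `τ` cost `ρ n` bits
  -- each, which leaves a margin of `ρ n` bits
  set k : ℕ := ⌊n * (1 - 3 * ρ)⌋₊
  have hk0 : (0 : ℝ) ≤ n * (1 - 3 * ρ) := mul_nonneg hn0.le (by linarith)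
  have hk1 : (k : ℝ) ≤ n * (1 - 3 * ρ) := Nat.floor_le hk0
  have hk2 : n * (1 - 3 * ρ) < k + 1 := Nat.lt_floor_add_one _
  set s : ℝ := 2 ^ (-(n * (1 - ρ))) with hs
  set τ : ℝ := 2 ^ (-(ρ * n)) with hτ
  have hs0 : 0 < s := by positivity
  have hτ0 : 0 < τ := by positivity
  obtain ⟨c', hc', herr⟩ := c.exists_code_of_secure_code (W := 2 ^ k) (by positivity) hs0.le hτ0
  refine ⟨c', ?_⟩
  have hrate : ∀ i, |c'.rate i - 1| ≤ 4 * ρ := by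
    intro i
    rw [c'.rate_eq_of_msgCard (hc' i), abs_le]
    have h1 : (k : ℝ) / n ≤ 1 - 3 * ρ := by
      rw [div_le_iff₀ hn0]
      linarith
    have h2 : 1 - 4 * ρ ≤ (k : ℝ) / n := by
      rw [le_div_iff₀ hn0]
      have h3 : ρ ^ 2 * (n * Real.log 2) ≤ ρ * n := by
        rw [pow_two, mul_assoc]
        refine mul_le_mul_of_nonneg_left ?_ hρ.le
        have h4 : n * Real.log 2 ≤ n := mul_le_of_le_one_right hn0.le hlog1.le
        have h5 : ρ * (n * Real.log 2) ≤ n * Real.log 2 :=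
          mul_le_of_le_one_left hnl.le (by linarith)
        linarith
      linarith
    constructor <;> linarith
  have hW : ((2 ^ k : ℕ) : ℝ) * (s / τ) ≤ ρ := by
    refine le_trans ?_ hn'
    rw [hs, hτ, Nat.cast_pow, Nat.cast_ofNat, ← Real.rpow_natCast, ← Real.rpow_sub two_pos,
      ← Real.rpow_add two_pos]
    refine Real.rpow_le_rpow_of_exponent_le one_le_two ?_
    linarith
  rw [Finset.sum_add_distrib]
  refine (add_le_add (Finset.sum_le_sum fun i _ => hrate i) (herr.trans
    (Finset.sum_le_sum (g := fun _ => ρ + 2 * ρ + ρ) fun i _ => ?_))).trans_eq ?_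
  swap
  · simp only [Finset.sum_const, Finset.card_univ, Fintype.card_fin, nsmul_eq_mul]
    ring
  have hmain := (c.ent_d_given_key_le i).trans (add_le_add_right (hβ i) _)
  have hD := ent_le_log_card c.weight_nonneg c.sum_weight fun ω => c.signal ω (.d i)
  have hcard : Real.log (Fintype.card (Fin n → Bool)) = n * Real.log 2 := by simp
  have h0 := ent_nonneg_cond c.weight_nonneg (fun ω => ω.2 (.B i)) fun ω => c.signal ω (.d i)
  refine add_le_add (add_le_add ?_ ?_) hW
  · have h1 := prob_not_plausible_mul_le c.weight_nonneg (fun ω => ω.2 (.B i))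
      (fun ω => c.signal ω (.d i)) hτ0
    have h2 : -Real.log τ = ρ * (n * Real.log 2) := by
      rw [hτ, Real.log_rpow two_pos]
      ring
    rw [h2] at h1
    rw [hcard] at hD
    refine le_of_mul_le_mul_right (h1.trans ?_) (mul_pos hρ hnl)
    linarith
  · have h1 := prob_lt_law_mul_le c.weight_nonneg c.sum_weight (fun ω => c.signal ω (.d i)) hs0
    have h2 : Real.log (s * Fintype.card (Fin n → Bool)) = ρ * (n * Real.log 2) := by
      have : (Fintype.card (Fin n → Bool) : ℝ) ≠ 0 := by exact_mod_cast Fintype.card_ne_zero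
      rw [Real.log_mul hs0.ne' this, hcard, hs, Real.log_rpow two_pos]
      ring
    rw [h2, hcard] at h1
    refine le_of_mul_le_mul_right (h1.trans ?_) (mul_pos hρ hnl)
    linarith

theorem Secrecy.Holds.weak {σ : Secrecy} {l : ℕ → ℝ} (h : σ.Holds l) : Secrecy.weak.Holds l := by
  cases σ with
  | perfect =>
    have : l = fun _ => 0 := funext h
    simp [Holds, this]
  | strong =>
    have h1 : Filter.Tendsto l Filter.atTop (nhds 0) := h
    simpa [Holds, div_eq_mul_inv] using
      h1.mul (tendsto_inv_atTop_nhds_zero_nat (𝕜 := ℝ))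
  | weak => exact h

/-- A code sequence that is good up to `η`, for every `η > 0`, gives feasibility. -/
theorem CommProblem.feasible_of_eventually_exists {P : CommProblem V E (Fin K)} (R : Fin K → ℝ)
    (h : ∀ η > 0, ∀ᶠ n in Filter.atTop, ∃ c : Code P n,
      ∑ i, (|c.rate i - R i| + c.errorProb i) ≤ η) : P.Feasible R := by
  have hne : ∀ n, Nonempty (Code P n) := fun n =>
    ⟨{  msgCard := fun _ => 1
        msgCard_pos := fun _ => one_pos
        keyCard := fun _ => 1
        keyProb := fun _ _ => 1
        keyProb_nonneg := fun _ _ => zero_le_one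
        keyProb_sum := fun _ => by simp
        encode := fun _ _ _ _ _ => false
        decode := fun _ _ _ _ => 0 }⟩
  have hnn : ∀ n (c : Code P n) i, 0 ≤ |c.rate i - R i| + c.errorProb i := fun n c i =>
    add_nonneg (abs_nonneg _) (c.errorProb_nonneg i)
  obtain ⟨c, hc⟩ := exists_seq_tendsto_zero
    (fun n (c : Code P n) => ∑ i, (|c.rate i - R i| + c.errorProb i))
    (fun n c => Finset.sum_nonneg fun i _ => hnn n c i) h
  refine ⟨c, fun i => ?_⟩
  have hle : ∀ n, |(c n).rate i - R i| + (c n).errorProb i ≤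
      ∑ i, (|(c n).rate i - R i| + (c n).errorProb i) := fun n =>
    Finset.single_le_sum (f := fun i => |(c n).rate i - R i| + (c n).errorProb i)
      (fun i _ => hnn n (c n) i) (Finset.mem_univ i)
  constructor
  · rw [tendsto_iff_dist_tendsto_zero]
    exact squeeze_zero (fun _ => dist_nonneg)
      (fun n => (le_add_of_nonneg_right ((c n).errorProb_nonneg i)).trans (hle n)) hc
  · exact squeeze_zero (fun n => (c n).errorProb_nonneg i)
      (fun n => (le_add_of_nonneg_left (abs_nonneg _)).trans (hle n)) hc

/-- Secrecy rates arbitrarily close to `K` make the unicast problem feasible. -/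
theorem feasible_of_secrecyFeasible [DecidableEq E] {σ : Secrecy}
    (h : ∀ δ > 0, ∃ R > (K : ℝ) - δ, (secureUnicast N).SecrecyFeasible
      (singleLinks (SecureLink E K)) σ R) : N.Feasible fun _ => 1 := by
  refine CommProblem.feasible_of_eventually_exists _ fun η hη => ?_
  have hlog : (0 : ℝ) < Real.log 2 := Real.log_pos one_lt_two
  obtain ⟨ρ, hρ, hρ3, hρη⟩ : ∃ ρ : ℝ, 0 < ρ ∧ ρ ≤ 1 / 3 ∧ 8 * K * ρ ≤ η := by
    refine ⟨min (1 / 3) (η / (8 * K + 1)), by positivity, min_le_left _ _, ?_⟩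
    have h1 : min (1 / 3) (η / (8 * K + 1)) ≤ η / (8 * K + 1) := min_le_right _ _
    rw [le_div_iff₀ (by positivity)] at h1
    have h2 : (0 : ℝ) < min (1 / 3) (η / (8 * K + 1)) := by positivity
    linarith
  obtain ⟨δ, hρ2⟩ : ∃ δ, ρ ^ 2 = 4 * δ := ⟨ρ ^ 2 / 4, by ring⟩
  have hδ : 0 < δ := by
    have := pow_pos hρ 2
    linarith
  obtain ⟨R, hR, c, hc, hleak⟩ := h δ hδ
  have e1 : ∀ᶠ n in Filter.atTop, (K : ℝ) - δ < (c n).rate () :=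
    (hc ()).1.eventually (lt_mem_nhds hR)
  have e2 : ∀ᶠ n in Filter.atTop, (c n).errorProb () < δ / (K + 1) :=
    (hc ()).2.eventually (gt_mem_nhds (by positivity))
  have hlim : ∀ i : Fin K, Filter.Tendsto (fun n => (c n).leakage {.c i} / (n : ℝ))
      Filter.atTop (nhds 0) := fun i =>
    (hleak _ (show {SecureLink.c i} ∈ singleLinks (SecureLink E K) from ⟨.c i, rfl⟩)).weak
  have e3 : ∀ᶠ n in Filter.atTop, ∀ i : Fin K, (c n).leakage {.c i} / (n : ℝ) < δ :=
    Filter.eventually_all.2 fun i => (hlim i).eventually (gt_mem_nhds hδ)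
  have e4 : ∀ᶠ n : ℕ in Filter.atTop, 1 / (δ * Real.log 2) ≤ (n : ℝ) :=
    tendsto_natCast_atTop_atTop.eventually_ge_atTop _
  have e5 : ∀ᶠ n : ℕ in Filter.atTop, (2 : ℝ) ^ (-(ρ * n)) ≤ ρ := by
    have h1 : Filter.Tendsto (fun n : ℕ => ((2 : ℝ) ^ (-ρ)) ^ n) Filter.atTop (nhds 0) :=
      tendsto_pow_atTop_nhds_zero_of_lt_one (by positivity)
        (Real.rpow_lt_one_of_one_lt_of_neg one_lt_two (by linarith))
    filter_upwards [h1.eventually (gt_mem_nhds hρ)] with n hn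
    rw [← Real.rpow_natCast, ← Real.rpow_mul zero_le_two] at hn
    rw [← neg_mul]
    exact hn.le
  filter_upwards [e1, e2, e3, e4, e5] with n h1 h2 h3 h4 h5
  rw [div_le_iff₀ (by positivity)] at h4
  have hn0 : (0 : ℝ) < n := by
    rcases Nat.eq_zero_or_pos n with h | h
    · simp [h] at h4
      linarith
    · exact_mod_cast h
  have hnl : 0 < n * Real.log 2 := mul_pos hn0 hlog
  have hlog1 : Real.log 2 < 1 := Real.log_two_lt_d9.trans (by norm_num)
  have h4' : 1 ≤ δ * (n * Real.log 2) := by linarith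
  refine ((c n).exists_code_of_deficit_le hρ hρ3 (fun i => ?_) (by rw [hρ2]; linarith) h5).imp
    fun c' hc' => hc'.trans hρη
  have hi := h3 i
  rw [div_lt_iff₀ hn0] at hi
  rw [Code.log_msgCard_eq _ _ (by exact_mod_cast hn0)]
  have hε0 := (c n).errorProb_nonneg ()
  have hε1 := (c n).errorProb_le_one ()
  rw [lt_div_iff₀ (by positivity)] at h2
  set ε := (c n).errorProb ()
  have h6 : (K : ℝ) - 2 * δ ≤ (1 - ε) * (c n).rate () := by
    have h7 : (1 - ε) * (K - δ) ≤ (1 - ε) * (c n).rate () :=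
      mul_le_mul_of_nonneg_left h1.le (by linarith)
    have h8 : 0 ≤ ε * δ := mul_nonneg hε0 hδ.le
    linarith
  have h9 := mul_le_mul_of_nonneg_right h6 hnl.le
  have h10 := mul_le_mul_of_nonneg_right hi.le hlog.le
  rw [hρ2]
  linarith

/-- The cut `e₁, …, e_K` bounds the rate. -/
theorem rate_le_of_communicates {R : ℝ} {c : ∀ n, Code (secureUnicast N) n}
    (h : (secureUnicast N).Communicates (fun _ => R) c) : R ≤ K := by
  have hlog : (0 : ℝ) < Real.log 2 := Real.log_pos one_lt_two
  have hlim : Filter.Tendsto (fun n : ℕ => (K : ℝ) + 1 / n) Filter.atTop (nhds K) := by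
    simpa using tendsto_const_nhds.add (tendsto_one_div_atTop_nhds_zero_nat (𝕜 := ℝ))
  refine le_of_tendsto_of_tendsto (h ()).1 hlim ?_
  filter_upwards [(h ()).2.eventually (gt_mem_nhds (show (0 : ℝ) < 1 / 2 by norm_num)),
    Filter.eventually_gt_atTop 0] with n h1 h2
  have hn0 : (0 : ℝ) < n := by exact_mod_cast h2
  have hM : (0 : ℝ) < (c n).msgCard () := by exact_mod_cast (c n).msgCard_pos ()
  have h3 := (c n).one_sub_errorProb_mul_msgCard_le
  have h4 : ((c n).msgCard () : ℝ) ≤ 2 ^ (n * K + 1) := by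
    rw [pow_succ]
    nlinarith
  have h5 := Real.log_le_log hM h4
  rw [Code.log_msgCard_eq _ _ h2, Real.log_pow] at h5
  push_cast at h5
  rw [← mul_assoc] at h5
  have h6 := le_of_mul_le_mul_right h5 hlog
  refine le_of_mul_le_mul_right (h6.trans_eq ?_) hn0
  field_simp

end Converse

/-! ### Restricting a code to bit strings and fixing its keys -/

section Restriction

variable {V E : Type*} [Fintype V] [DecidableEq V] {K m : ℕ} {N : CommProblem V E (Fin K)}

open Classical in
/-- On average over the keys and over a random translation of an embedding of the bit strings into
the messages, the error probability for uniform bit strings is that of the code. -/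
theorem Code.exists_restriction (c : Code N m) {k : ℕ} (hk : ∀ i, 2 ^ k ≤ c.msgCard i) :
    ∃ (φ : ∀ i, (Fin k → Bool) → Fin (c.msgCard i)) (κ : ∀ v, Fin (c.keyCard v)),
      (∀ i, Function.Injective (φ i)) ∧
      ∑ i, ∑ u : Fin K → Fin k → Bool, (Fintype.card (Fin K → Fin k → Bool) : ℝ)⁻¹ *
        (if c.output (fun j => φ j (u j), κ) i ≠ φ i (u i) then 1 else 0) ≤
      ∑ i, c.errorProb i := by
  have : ∀ i, NeZero (c.msgCard i) := fun i => ⟨(c.msgCard_pos i).ne'⟩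
  obtain ⟨emb⟩ : Nonempty (∀ i, (Fin k → Bool) ↪ Fin (c.msgCard i)) :=
    Classical.nonempty_pi.2 fun i =>
      Function.Embedding.nonempty_of_card_le (by simpa using hk i)
  obtain ⟨z, hz⟩ := exists_le_of_sum_le (p := c.weight)
    (f := fun z => ∑ i, ∑ u : Fin K → Fin k → Bool,
      (Fintype.card (Fin K → Fin k → Bool) : ℝ)⁻¹ *
        (if c.output (fun j => emb j (u j) + z.1 j, z.2) i ≠ emb i (u i) + z.1 i then 1 else 0))
    c.weight_nonneg c.sum_weight (b := ∑ i, c.errorProb i) (by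
      simp_rw [Finset.mul_sum]
      rw [Finset.sum_comm]
      refine Finset.sum_le_sum fun i _ => ?_
      rw [Finset.sum_comm]
      have h : ∀ u : Fin K → Fin k → Bool, ∑ z, c.weight z *
          ((Fintype.card (Fin K → Fin k → Bool) : ℝ)⁻¹ *
          (if c.output (fun j => emb j (u j) + z.1 j, z.2) i ≠ emb i (u i) + z.1 i
            then 1 else 0)) =
          (Fintype.card (Fin K → Fin k → Bool) : ℝ)⁻¹ * c.errorProb i := by
        intro u
        let τ : c.Sample ≃ c.Sample :=
          (Equiv.addLeft (fun j => emb j (u j) : ∀ j, Fin (c.msgCard j))).prodCongr (Equiv.refl _)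
        rw [errorProb, prob, Finset.mul_sum]
        refine Eq.trans ?_ (Equiv.sum_comp τ _)
        refine Finset.sum_congr rfl fun z _ => ?_
        have h1 : τ z = (fun j => emb j (u j) + z.1 j, z.2) := rfl
        have h2 : c.weight (τ z) = c.weight z := rfl
        rw [h2, h1]
        dsimp only
        split_ifs <;> ring
      simp_rw [h]
      simp)
  exact ⟨fun i x => emb i x + z.1 i, z.2,
    fun i x y h => (emb i).injective (add_right_cancel h), hz⟩

end Restriction

/-! ### The pipelined secure code -/

section Pipeline

variable {V E : Type*} [DecidableEq V] {K m : ℕ} {N : CommProblem V E (Fin K)}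

/-- The bits of one stream: `L` blocks of `k` bits for each `i`. -/
abbrev Bits (K L k : ℕ) : Type := Fin K → Fin L → Fin k → Bool

/-- Numbering of the bit patterns. -/
noncomputable def bitsEquiv (K L k : ℕ) : Fin (2 ^ (K * (L * k))) ≃ Bits K L k :=
  (Fintype.equivFinOfCardEq (by simp [← pow_mul, mul_comm])).symm

/-- Blocks of `k` bits, sent in the first `k` slots of consecutive periods of `m` slots. -/
def stream (m : ℕ) {L k : ℕ} (u : Fin L → Fin k → Bool) (t : ℕ) : Bool :=
  if h : t / m < L ∧ t % m < k then u ⟨t / m, h.1⟩ ⟨t % m, h.2⟩ else false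

theorem stream_xor (m : ℕ) {L k : ℕ} (u v : Fin L → Fin k → Bool) (t : ℕ) :
    stream m (fun l q => xor (u l q) (v l q)) t = xor (stream m u t) (stream m v t) := by
  unfold stream
  split_ifs <;> rfl

theorem stream_block {m L k : ℕ} (hkm : k ≤ m) (u : Fin L → Fin k → Bool) (l : Fin L) (q : Fin k) :
    stream m u (l * m + q) = u l q := by
  have hq : (q : ℕ) < m := q.2.trans_le hkm
  have hm : 0 < m := by omega
  have h1 : (l * m + q : ℕ) / m = l := by
    rw [mul_comm, Nat.mul_add_div hm, Nat.div_eq_of_lt hq, add_zero]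
  have h2 : (l * m + q : ℕ) % m = q := by
    rw [mul_comm, Nat.mul_add_mod, Nat.mod_eq_of_lt hq]
  simp [stream, h1, h2, q.2]

/-- The bit sent on a link in slot `t`, as a function of the message `μ` and key `γ` at its tail
and of the bits `r` received there. With `Rᵢ`, `κᵢ`, `Fᵢ` the keys of `S`, `Bᵢ`, `Fᵢ`: the links
`S → Aᵢ` carry `Mᵢ + Rᵢ` and `Rᵢ`, and `cᵢ` carries `Mᵢ + κᵢ`; in each period of `m` slots the
embedded network runs the code `c` (with keys `κ₀` and messages in the image of `φ`) on the block of
the `κᵢ` sent in the previous period; in the next period `dᵢ` carries the result, and `eᵢ` carries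
the sum of `cᵢ`, `dᵢ` and `Fᵢ`, delayed accordingly. -/
noncomputable def linkBit (hm : 0 < m) {L k : ℕ} (c : Code N m)
    (φ : ∀ i, (Fin k → Bool) → Fin (c.msgCard i)) (κ₀ : ∀ v, Fin (c.keyCard v))
    (μ γ : Bits K L k) (r : SecureLink E K → ℕ → Bool) : SecureLink E K → ℕ → Bool
  | .a i 0, t => xor (stream m (μ i) t) (stream m (γ i) t)
  | .a i 1, t => stream m (γ i) t
  | .b i, t => stream m (γ i) t
  | .b' i, t => stream m (γ i) t
  | .f i, t => stream m (γ i) t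
  | .f' i, t => stream m (γ i) t
  | .c i, t => if m ≤ t then
      xor (xor (r (.a i 0) (t - m)) (r (.a i 1) (t - m))) (r (.b i) (t - m)) else false
  | .inner e, t => c.encode e ⟨t % m, Nat.mod_lt _ hm⟩
      (fun j => φ j fun q => r (.b' j) ((t / m - 1) * m + q)) (κ₀ (N.tail e))
      (fun e' s => r (.inner e') (t / m * m + s))
  | .d i, t => if h : t % m < k then Function.invFun (φ i)
      (c.decode i (fun j => φ j fun q => r (.b' j) ((t / m - 2) * m + q)) (κ₀ (N.dst i))
        (fun e' s => r (.inner e') ((t / m - 1) * m + s))) ⟨t % m, h⟩ else false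
  | .e i, t => if 3 * m ≤ t then
      xor (xor (r (.d i) (t - m)) (r (.c i) (t - 2 * m))) (r (.f' i) (t - 3 * m)) else false

/-- The pipelined secure code of length `n`, see `linkBit`. All keys are uniform bit patterns. -/
noncomputable def pipeline (hm : 0 < m) (L k n : ℕ) (c : Code N m)
    (φ : ∀ i, (Fin k → Bool) → Fin (c.msgCard i)) (κ₀ : ∀ v, Fin (c.keyCard v)) :
    Code (secureUnicast N) n where
  msgCard _ := 2 ^ (K * (L * k))
  msgCard_pos _ := by positivity
  keyCard _ := 2 ^ (K * (L * k))
  keyProb _ _ := ((2 ^ (K * (L * k)) : ℕ) : ℝ)⁻¹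
  keyProb_nonneg _ _ := by positivity
  keyProb_sum _ := by simp
  encode e t msgs key hist := linkBit hm c φ κ₀
    (if h : SecureNode.S = (secureUnicast N).tail e then bitsEquiv K L k (msgs ⟨(), h⟩)
      else fun _ _ _ => false)
    (bitsEquiv K L k key)
    (fun e' s => if h : (secureUnicast N).head e' = (secureUnicast N).tail e ∧ s < t then
      hist ⟨e', h.1⟩ ⟨s, h.2⟩ else false) e t
  decode _ _ key hist := (bitsEquiv K L k).symm fun i l q =>
    if h : (l + 3) * m + q < n then
      xor (hist ⟨.e i, rfl⟩ ⟨(l + 3) * m + q, h⟩)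
        (hist ⟨.f i, rfl⟩ ⟨l * m + q, lt_of_le_of_lt (by gcongr; omega) h⟩)
    else false

end Pipeline

/-! ### The signals of the pipelined code -/

section PipelineSignals

variable {V E : Type*} [DecidableEq V] {K m : ℕ} {N : CommProblem V E (Fin K)}

/-- The signal on a link, continued by `false` after the last slot. -/
def Code.signalNat {V E ι : Type*} {P : CommProblem V E ι} {n : ℕ} (c : Code P n) (ω : c.Sample)
    (e : E) (t : ℕ) : Bool :=
  if h : t < n then c.signal ω e ⟨t, h⟩ else false

theorem Code.encode_congr_slot {V E ι : Type*} {P : CommProblem V E ι} {n : ℕ} (c : Code P n) (e : E)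
    {x y : Fin n} (h : x = y) (msgs : ∀ i : {i : ι // P.src i = P.tail e}, Fin (c.msgCard i))
    (key : Fin (c.keyCard (P.tail e))) (g : {e' : E // P.head e' = P.tail e} → ℕ → Bool) :
    c.encode e x msgs key (fun e' s => g e' s) = c.encode e y msgs key (fun e' s => g e' s) := by
  subst h
  rfl

variable (hm : 0 < m) {L k n : ℕ} (c : Code N m) (φ : ∀ i, (Fin k → Bool) → Fin (c.msgCard i))
  (κ₀ : ∀ v, Fin (c.keyCard v)) (ω : (pipeline hm L k n c φ κ₀).Sample)

/-- The message of the pipelined code as a bit pattern. -/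
noncomputable def messageBits : Bits K L k := bitsEquiv K L k (ω.1 ())

/-- The key of the vertex `v` in the pipelined code as a bit pattern. -/
noncomputable def keyBits (v : SecureNode V K) : Bits K L k := bitsEquiv K L k (ω.2 v)

theorem pipeline_signalNat (e : SecureLink E K) {t : ℕ} (ht : t < n) :
    (pipeline hm L k n c φ κ₀).signalNat ω e t = linkBit hm c φ κ₀
      (if SecureNode.S = (secureUnicast N).tail e then messageBits hm c φ κ₀ ω
        else fun _ _ _ => false)
      (keyBits hm c φ κ₀ ω ((secureUnicast N).tail e))
      (fun e' s => if (secureUnicast N).head e' = (secureUnicast N).tail e ∧ s < t then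
        (pipeline hm L k n c φ κ₀).signalNat ω e' s else false) e t := by
  rw [Code.signalNat, dif_pos ht, Code.signal_eq]
  change linkBit hm c φ κ₀ (L := L) (k := k)
    (if h : SecureNode.S = (secureUnicast N).tail e then bitsEquiv K L k (ω.1 ())
      else fun _ _ _ => false)
    (bitsEquiv K L k (ω.2 _))
    (fun e' s => if h : (secureUnicast N).head e' = (secureUnicast N).tail e ∧ s < t then
      (pipeline hm L k n c φ κ₀).signal ω e' ⟨s, h.2.trans ht⟩ else false) e t = _
  congr 1
  funext e' s
  by_cases h : (secureUnicast N).head e' = (secureUnicast N).tail e ∧ s < t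
  · rw [dif_pos h, if_pos h, Code.signalNat, dif_pos (h.2.trans ht)]
  · rw [dif_neg h, if_neg h]

theorem pipeline_a_zero (i : Fin K) {t : ℕ} (ht : t < n) :
    (pipeline hm L k n c φ κ₀).signalNat ω (.a i 0) t =
      xor (stream m (messageBits hm c φ κ₀ ω i) t) (stream m (keyBits hm c φ κ₀ ω .S i) t) := by
  rw [pipeline_signalNat hm c φ κ₀ ω _ ht]
  rfl

theorem pipeline_a_one (i : Fin K) {t : ℕ} (ht : t < n) :
    (pipeline hm L k n c φ κ₀).signalNat ω (.a i 1) t =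
      stream m (keyBits hm c φ κ₀ ω .S i) t := by
  rw [pipeline_signalNat hm c φ κ₀ ω _ ht]
  rfl

theorem pipeline_b (i : Fin K) {t : ℕ} (ht : t < n) :
    (pipeline hm L k n c φ κ₀).signalNat ω (.b i) t =
      stream m (keyBits hm c φ κ₀ ω (.B i) i) t := by
  rw [pipeline_signalNat hm c φ κ₀ ω _ ht]
  rfl

theorem pipeline_b' (i : Fin K) {t : ℕ} (ht : t < n) :
    (pipeline hm L k n c φ κ₀).signalNat ω (.b' i) t =
      stream m (keyBits hm c φ κ₀ ω (.B i) i) t := by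
  rw [pipeline_signalNat hm c φ κ₀ ω _ ht]
  rfl

theorem pipeline_f (i : Fin K) {t : ℕ} (ht : t < n) :
    (pipeline hm L k n c φ κ₀).signalNat ω (.f i) t =
      stream m (keyBits hm c φ κ₀ ω (.F i) i) t := by
  rw [pipeline_signalNat hm c φ κ₀ ω _ ht]
  rfl

theorem pipeline_f' (i : Fin K) {t : ℕ} (ht : t < n) :
    (pipeline hm L k n c φ κ₀).signalNat ω (.f' i) t =
      stream m (keyBits hm c φ κ₀ ω (.F i) i) t := by
  rw [pipeline_signalNat hm c φ κ₀ ω _ ht]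
  rfl

theorem pipeline_c (i : Fin K) {t : ℕ} (ht : t < n) :
    (pipeline hm L k n c φ κ₀).signalNat ω (.c i) t = if m ≤ t then
      xor (stream m (messageBits hm c φ κ₀ ω i) (t - m))
        (stream m (keyBits hm c φ κ₀ ω (.B i) i) (t - m)) else false := by
  rw [pipeline_signalNat hm c φ κ₀ ω _ ht]
  simp only [linkBit]
  by_cases h : m ≤ t
  · have h1 : t - m < t := by omega
    rw [if_pos h, if_pos h, if_pos ⟨rfl, h1⟩, if_pos ⟨rfl, h1⟩, if_pos ⟨rfl, h1⟩, pipeline_a_zero _ _ _ _ _ _ (by omega),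
      pipeline_a_one _ _ _ _ _ _ (by omega), pipeline_b _ _ _ _ _ _ (by omega)]
    simp
  · rw [if_neg h, if_neg h]

theorem pipeline_e (i : Fin K) {t : ℕ} (ht : t < n) :
    (pipeline hm L k n c φ κ₀).signalNat ω (.e i) t = if 3 * m ≤ t then
      xor (xor ((pipeline hm L k n c φ κ₀).signalNat ω (.d i) (t - m))
        (xor (stream m (messageBits hm c φ κ₀ ω i) (t - 3 * m))
          (stream m (keyBits hm c φ κ₀ ω (.B i) i) (t - 3 * m))))
        (stream m (keyBits hm c φ κ₀ ω (.F i) i) (t - 3 * m)) else false := by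
  rw [pipeline_signalNat hm c φ κ₀ ω _ ht]
  simp only [linkBit]
  by_cases h : 3 * m ≤ t
  · rw [if_pos h, if_pos h, if_pos ⟨rfl, by omega⟩, if_pos ⟨rfl, by omega⟩, if_pos ⟨rfl, by omega⟩,
      pipeline_c _ _ _ _ _ _ (by omega), pipeline_f' _ _ _ _ _ _ (by omega), if_pos (by omega),
      show t - 2 * m - m = t - 3 * m by omega]
  · rw [if_neg h, if_neg h]

/-- The messages on which the embedded network runs the code `c`, one block after the other. -/
noncomputable def blockMessage (l : Fin L) : c.Msg :=
  fun j => φ j (keyBits hm c φ κ₀ ω (.B j) j l)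

theorem pipeline_inner (hkm : k ≤ m) (l : Fin L) {q : ℕ} (hq : q < m) (ht : (l + 1) * m + q < n) (e : E) :
    (pipeline hm L k n c φ κ₀).signalNat ω (.inner e) ((l + 1) * m + q) =
      c.signal (blockMessage hm c φ κ₀ ω l, κ₀) e ⟨q, hq⟩ := by
  induction q using Nat.strong_induction_on generalizing e with
  | _ q ih =>
    rw [pipeline_signalNat hm c φ κ₀ ω _ ht, Code.signal_eq]
    have h1 : ((l + 1) * m + q) / m = l + 1 := by
      rw [mul_comm, Nat.mul_add_div hm, Nat.div_eq_of_lt hq, add_zero]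
    have h2 : ((l + 1) * m + q) % m = q := by
      rw [mul_comm, Nat.mul_add_mod, Nat.mod_eq_of_lt hq]
    simp only [linkBit, h1, Nat.add_sub_cancel]
    refine (c.encode_congr_slot e (y := ⟨q, hq⟩) (Fin.ext h2) _ _ fun e' s =>
      if (secureUnicast N).head (.inner e'.1) = (secureUnicast N).tail (.inner e) ∧
        (l + 1) * m + s < (l + 1) * m + q then
      (pipeline hm L k n c φ κ₀).signalNat ω (.inner e'.1) ((l + 1) * m + s) else false).trans ?_
    congr 1
    · funext j
      refine congrArg (φ j) (funext fun q' => ?_)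
      have h3 : (l : ℕ) * m + q' < (l + 1) * m + q := by
        have := q'.2
        rw [add_mul, one_mul]
        omega
      rw [if_pos ⟨congrArg SecureNode.inner j.2, h3⟩, pipeline_b' _ _ _ _ _ _ (h3.trans ht),
        stream_block hkm]
    · funext e' s
      have h3 : ((l : ℕ) + 1) * m + s < (l + 1) * m + q := by
        exact Nat.add_lt_add_left s.2 _
      rw [if_pos ⟨congrArg SecureNode.inner e'.2, h3⟩]
      exact ih s s.2 (s.2.trans hq) (h3.trans ht) e'

theorem pipeline_d (hkm : k ≤ m) (i : Fin K) (l : Fin L) (q : Fin k) (ht : (l + 2) * m + q < n) :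
    (pipeline hm L k n c φ κ₀).signalNat ω (.d i) ((l + 2) * m + q) =
      Function.invFun (φ i) (c.output (blockMessage hm c φ κ₀ ω l, κ₀) i) q := by
  have hq : (q : ℕ) < m := q.2.trans_le hkm
  rw [pipeline_signalNat hm c φ κ₀ ω _ ht]
  have h1 : ((l + 2) * m + q : ℕ) / m = l + 2 := by
    rw [mul_comm, Nat.mul_add_div hm, Nat.div_eq_of_lt hq, add_zero]
  have h2 : ((l + 2) * m + q : ℕ) % m = q := by
    rw [mul_comm, Nat.mul_add_mod, Nat.mod_eq_of_lt hq]
  simp only [linkBit, h1, h2, q.2, dif_pos, Fin.eta, Nat.add_sub_cancel]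
  refine congrArg (fun x => Function.invFun (φ i) x q) ?_
  rw [Code.output]
  congr 1
  · funext j
    refine congrArg (φ j) (funext fun q' => ?_)
    have h3 : (l : ℕ) * m + q' < (l + 2) * m + q := by
      have := q'.2
      rw [add_mul]
      omega
    rw [if_pos ⟨congrArg SecureNode.inner j.2, h3⟩, pipeline_b' _ _ _ _ _ _ (h3.trans ht),
      stream_block hkm]
  · funext e' s
    have h3 : ((l : ℕ) + 1) * m + s < (l + 2) * m + q := by
      have := s.2
      rw [add_mul, add_mul]
      omega
    rw [show (l : ℕ) + 2 - 1 = l + 1 by omega, if_pos ⟨congrArg SecureNode.inner e'.2, h3⟩]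
    exact pipeline_inner hm c φ κ₀ ω hkm l s.2 (h3.trans ht) e'

/-- The pipelined code decodes correctly if every run of the code `c` does. -/
theorem pipeline_output (hkm : k ≤ m) (hφ : ∀ i, Function.Injective (φ i)) (hn : (L + 3) * m ≤ n)
    (hc : ∀ l i, c.output (blockMessage hm c φ κ₀ ω l, κ₀) i = blockMessage hm c φ κ₀ ω l i) :
    (pipeline hm L k n c φ κ₀).output ω () = ω.1 () := by
  have hsig : ∀ e (t : Fin n), (pipeline hm L k n c φ κ₀).signal ω e t =
      (pipeline hm L k n c φ κ₀).signalNat ω e t := by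
    intro e t
    rw [Code.signalNat, dif_pos t.2]
  have key : (pipeline hm L k n c φ κ₀).output ω () =
      (bitsEquiv K L k).symm (messageBits hm c φ κ₀ ω) := by
    rw [Code.output]
    refine congrArg (bitsEquiv K L k).symm (funext fun i => funext fun l => funext fun q => ?_)
    have hq : (q : ℕ) < m := q.2.trans_le hkm
    have hlt : ((l : ℕ) + 3) * m + q < n := by
      refine lt_of_lt_of_le ?_ hn
      have : ((l : ℕ) + 3 + 1) * m ≤ (L + 3) * m := Nat.mul_le_mul_right _ (by omega)
      rw [add_mul _ 1, one_mul] at this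
      omega
    have h3 : ((l : ℕ) + 3) * m + q = l * m + q + 3 * m := by ring
    have h2 : ((l : ℕ) + 3) * m + q - m = (l + 2) * m + q := by
      have : ((l : ℕ) + 3) * m = (l + 2) * m + m := by ring
      omega
    refine (dif_pos hlt).trans ?_
    change xor ((pipeline hm L k n c φ κ₀).signal ω (.e i) ⟨_, hlt⟩)
      ((pipeline hm L k n c φ κ₀).signal ω (.f i) ⟨l * m + q, _⟩) = _
    rw [hsig, hsig, pipeline_e _ _ _ _ _ _ hlt, if_pos (by omega), h2,
      pipeline_d _ _ _ _ _ hkm _ _ _ (by omega), hc, pipeline_f _ _ _ _ _ _ (by simp only; omega),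
      show ((l : ℕ) + 3) * m + q - 3 * m = l * m + q by omega, stream_block hkm, stream_block hkm,
      stream_block hkm, blockMessage, Function.leftInverse_invFun (hφ i)]
    generalize messageBits hm c φ κ₀ ω i l q = x
    generalize keyBits hm c φ κ₀ ω (.B i) i l q = y
    generalize keyBits hm c φ κ₀ ω (.F i) i l q = z
    cases x <;> cases y <;> cases z <;> rfl
  exact key.trans (Equiv.symm_apply_apply _ _)

end PipelineSignals

/-! ### Perfect secrecy and reliability of the pipelined code -/

section Secrecy

/-- A link leaks nothing if any two messages can be exchanged by a bijection of the sample space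
that preserves probabilities and the signal on the link. -/
theorem Code.leakage_eq_zero {V E ι : Type*} [Fintype V] [Fintype ι] [DecidableEq V]
    [DecidableEq ι] [DecidableEq E] {P : CommProblem V E ι} {n : ℕ} (c : Code P n) (e : E)
    (h : ∀ m m' : c.Msg, ∃ τ : Equiv.Perm c.Sample, (∀ ω, c.weight (τ ω) = c.weight ω) ∧
      (∀ ω, (τ ω).1 = m' ↔ ω.1 = m) ∧ ∀ ω, c.signal (τ ω) e = c.signal ω e) :
    c.leakage {e} = 0 := by
  rw [leakage_singleton, ent_pair_of_indep c.weight_nonneg, sub_self, zero_div]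
  intro m y
  have hconst : ∀ m', law c.weight (fun ω => (ω.1, c.signal ω e)) (m', y) =
      law c.weight (fun ω => (ω.1, c.signal ω e)) (m, y) := by
    intro m'
    obtain ⟨τ, hw, hm, hs⟩ := h m m'
    rw [law, law, ← Equiv.sum_comp τ]
    refine Finset.sum_congr rfl fun ω _ => ?_
    simp only [Prod.mk.injEq, hm, hs, hw]
  have hm : ∀ m', law c.weight (fun ω => ω.1) m' = law c.weight (fun ω => ω.1) m := by
    intro m'
    obtain ⟨τ, hw, hm, -⟩ := h m m'
    rw [law, law, ← Equiv.sum_comp τ]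
    refine Finset.sum_congr rfl fun ω _ => ?_
    simp only [hm, hw]
    split_ifs <;> rfl
  have h1 := sum_law_pair_left c.weight (fun ω => ω.1) (fun ω => c.signal ω e) y
  have h2 := sum_law c.weight (fun ω => ω.1)
  simp only [hconst, hm, Finset.sum_const, nsmul_eq_mul, c.sum_weight] at h1 h2
  change _ = law c.weight (fun ω => ω.1) m * law c.weight (fun ω => c.signal ω e) y
  rw [← h1, mul_left_comm, ← mul_assoc, h2, one_mul]

variable {V E : Type*} [DecidableEq V] {K m : ℕ} {N : CommProblem V E (Fin K)}
variable (hm : 0 < m) {L k n : ℕ} (c : Code N m) (φ : ∀ i, (Fin k → Bool) → Fin (c.msgCard i))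
  (κ₀ : ∀ v, Fin (c.keyCard v))

/-- The message and the keys of the pipelined code are shifted by given bit patterns. -/
noncomputable def xorShift (δ : Bits K L k) (D : SecureNode V K → Bits K L k)
    (ω : (pipeline hm L k n c φ κ₀).Sample) : (pipeline hm L k n c φ κ₀).Sample :=
  (fun _ => (bitsEquiv K L k).symm fun i l q => xor (messageBits hm c φ κ₀ ω i l q) (δ i l q),
    fun v => (bitsEquiv K L k).symm fun i l q => xor (keyBits hm c φ κ₀ ω v i l q) (D v i l q))

theorem messageBits_xorShift (δ : Bits K L k) (D : SecureNode V K → Bits K L k)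
    (ω : (pipeline hm L k n c φ κ₀).Sample) :
    messageBits hm c φ κ₀ (xorShift hm c φ κ₀ δ D ω) =
      fun i l q => xor (messageBits hm c φ κ₀ ω i l q) (δ i l q) :=
  Equiv.apply_symm_apply _ _

theorem keyBits_xorShift (δ : Bits K L k) (D : SecureNode V K → Bits K L k)
    (ω : (pipeline hm L k n c φ κ₀).Sample) (v : SecureNode V K) :
    keyBits hm c φ κ₀ (xorShift hm c φ κ₀ δ D ω) v =
      fun i l q => xor (keyBits hm c φ κ₀ ω v i l q) (D v i l q) :=
  Equiv.apply_symm_apply _ _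

theorem pipeline_sample_ext {ω ω' : (pipeline hm L k n c φ κ₀).Sample}
    (h : messageBits hm c φ κ₀ ω = messageBits hm c φ κ₀ ω')
    (h' : ∀ v, keyBits hm c φ κ₀ ω v = keyBits hm c φ κ₀ ω' v) : ω = ω' :=
  Prod.ext (funext fun _ => (bitsEquiv K L k).injective h)
    (funext fun v => (bitsEquiv K L k).injective (h' v))

theorem xorShift_involutive (δ : Bits K L k) (D : SecureNode V K → Bits K L k) :
    Function.Involutive (xorShift hm c φ κ₀ (n := n) δ D) := by
  intro ω
  refine pipeline_sample_ext hm c φ κ₀ ?_ fun v => ?_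
  · simp [messageBits_xorShift]
  · simp [keyBits_xorShift]

theorem keyBits_xorShift_of_eq_false {δ : Bits K L k} {D : SecureNode V K → Bits K L k}
    (ω : (pipeline hm L k n c φ κ₀).Sample) {v : SecureNode V K}
    (hD : D v = fun _ _ _ => false) :
    (xorShift hm c φ κ₀ δ D ω).2 v = ω.2 v := by
  refine (bitsEquiv K L k).injective ?_
  refine (keyBits_xorShift hm c φ κ₀ δ D ω v).trans ?_
  simp [hD, keyBits]

variable [Fintype V]

theorem pipeline_leakage_of_shift [DecidableEq E] (e : SecureLink E K)
    (D : Bits K L k → SecureNode V K → Bits K L k)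
    (h : ∀ δ ω, (pipeline hm L k n c φ κ₀).signal (xorShift hm c φ κ₀ δ (D δ) ω) e =
      (pipeline hm L k n c φ κ₀).signal ω e) :
    (pipeline hm L k n c φ κ₀).leakage {e} = 0 := by
  refine Code.leakage_eq_zero _ e fun u u' => ?_
  let δ : Bits K L k := fun i l q =>
    xor (bitsEquiv K L k (u ()) i l q) (bitsEquiv K L k (u' ()) i l q)
  refine ⟨(xorShift_involutive hm c φ κ₀ δ (D δ)).toPerm, fun ω => rfl, fun ω => ?_, h δ⟩
  have h1 := messageBits_xorShift hm c φ κ₀ δ (D δ) ω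
  constructor
  · intro hω
    funext x
    refine (bitsEquiv K L k).injective ?_
    have h2 : messageBits hm c φ κ₀ (xorShift hm c φ κ₀ δ (D δ) ω) = bitsEquiv K L k (u' ()) :=
      congrArg (fun w => bitsEquiv K L k (w ())) hω
    rw [h1] at h2
    change messageBits hm c φ κ₀ ω = bitsEquiv K L k (u ())
    funext i l q
    have h3 := congrFun (congrFun (congrFun h2 i) l) q
    simp only [δ] at h3
    generalize messageBits hm c φ κ₀ ω i l q = a at h3 ⊢
    generalize bitsEquiv K L k (u ()) i l q = b at h3 ⊢
    revert h3
    generalize bitsEquiv K L k (u' ()) i l q = d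
    cases a <;> cases b <;> cases d <;> simp
  · intro hω
    funext x
    refine (bitsEquiv K L k).injective ?_
    refine h1.trans ?_
    have h2 : messageBits hm c φ κ₀ ω = bitsEquiv K L k (u ()) :=
      congrArg (fun w => bitsEquiv K L k (w ())) hω
    rw [h2]
    simp [δ]

theorem pipeline_leakage [DecidableEq E] (e : SecureLink E K) :
    (pipeline hm L k n c φ κ₀).leakage {e} = 0 := by
  have hsig : ∀ ω ω' : (pipeline hm L k n c φ κ₀).Sample, (∀ t < n,
      (pipeline hm L k n c φ κ₀).signalNat ω e t = (pipeline hm L k n c φ κ₀).signalNat ω' e t) →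
      (pipeline hm L k n c φ κ₀).signal ω e = (pipeline hm L k n c φ κ₀).signal ω' e := by
    intro ω ω' h
    funext t
    have := h t t.2
    rwa [Code.signalNat, Code.signalNat, dif_pos t.2, dif_pos t.2] at this
  let zero : Bits K L k := fun _ _ _ => false
  have hz : ∀ {δ : Bits K L k} {D : SecureNode V K → Bits K L k}
      (ω : (pipeline hm L k n c φ κ₀).Sample) {v : SecureNode V K}, D v = zero →
      keyBits hm c φ κ₀ (xorShift hm c φ κ₀ δ D ω) v = keyBits hm c φ κ₀ ω v := by
    intro δ D ω v hD
    rw [keyBits, keyBits_xorShift_of_eq_false hm c φ κ₀ ω hD]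
    rfl
  -- the key that masks the signal on each link is shifted together with the message
  cases e with
  | a i j =>
    obtain rfl | rfl : j = 0 ∨ j = 1 := by omega
    · refine pipeline_leakage_of_shift hm c φ κ₀ _ (fun δ v => if v = .S then δ else zero)
        fun δ ω => hsig _ _ fun t ht => ?_
      rw [pipeline_a_zero _ _ _ _ _ _ ht, pipeline_a_zero _ _ _ _ _ _ ht, messageBits_xorShift,
        keyBits_xorShift, if_pos rfl, stream_xor, stream_xor]
      cases stream m (δ i) t <;> simp
    · refine pipeline_leakage_of_shift hm c φ κ₀ _ (fun _ _ => zero)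
        fun δ ω => hsig _ _ fun t ht => ?_
      rw [pipeline_a_one _ _ _ _ _ _ ht, pipeline_a_one _ _ _ _ _ _ ht, hz _ rfl]
  | b i =>
    refine pipeline_leakage_of_shift hm c φ κ₀ _ (fun _ _ => zero)
      fun δ ω => hsig _ _ fun t ht => ?_
    rw [pipeline_b _ _ _ _ _ _ ht, pipeline_b _ _ _ _ _ _ ht, hz _ rfl]
  | b' i =>
    refine pipeline_leakage_of_shift hm c φ κ₀ _ (fun _ _ => zero)
      fun δ ω => hsig _ _ fun t ht => ?_
    rw [pipeline_b' _ _ _ _ _ _ ht, pipeline_b' _ _ _ _ _ _ ht, hz _ rfl]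
  | f i =>
    refine pipeline_leakage_of_shift hm c φ κ₀ _ (fun _ _ => zero)
      fun δ ω => hsig _ _ fun t ht => ?_
    rw [pipeline_f _ _ _ _ _ _ ht, pipeline_f _ _ _ _ _ _ ht, hz _ rfl]
  | f' i =>
    refine pipeline_leakage_of_shift hm c φ κ₀ _ (fun _ _ => zero)
      fun δ ω => hsig _ _ fun t ht => ?_
    rw [pipeline_f' _ _ _ _ _ _ ht, pipeline_f' _ _ _ _ _ _ ht, hz _ rfl]
  | c i =>
    refine pipeline_leakage_of_shift hm c φ κ₀ _ (fun δ v => if v = .B i then δ else zero)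
      fun δ ω => hsig _ _ fun t ht => ?_
    rw [pipeline_c _ _ _ _ _ _ ht, pipeline_c _ _ _ _ _ _ ht, messageBits_xorShift,
      keyBits_xorShift, if_pos rfl, stream_xor, stream_xor]
    cases stream m (δ i) (t - m) <;> simp
  | d i =>
    exact pipeline_leakage_of_shift hm c φ κ₀ _ (fun _ _ => zero) fun δ ω =>
      Code.signal_d_congr _ (fun j => keyBits_xorShift_of_eq_false hm c φ κ₀ ω rfl)
        (fun v => keyBits_xorShift_of_eq_false hm c φ κ₀ ω rfl) i
  | inner e =>
    exact pipeline_leakage_of_shift hm c φ κ₀ _ (fun _ _ => zero) fun δ ω =>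
      Code.signal_inner_congr _ (fun j => keyBits_xorShift_of_eq_false hm c φ κ₀ ω rfl)
        (fun v => keyBits_xorShift_of_eq_false hm c φ κ₀ ω rfl) e
  | e i =>
    refine pipeline_leakage_of_shift hm c φ κ₀ _ (fun δ v => if v = .F i then δ else zero)
      fun δ ω => hsig _ _ fun t ht => ?_
    have hd : (pipeline hm L k n c φ κ₀).signalNat
        (xorShift hm c φ κ₀ δ (fun v => if v = .F i then δ else zero) ω) (.d i) (t - m) =
        (pipeline hm L k n c φ κ₀).signalNat ω (.d i) (t - m) := by
      rw [Code.signalNat, Code.signalNat, Code.signal_d_congr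
        (pipeline hm L k n c φ κ₀)
        (fun j => keyBits_xorShift_of_eq_false hm c φ κ₀ ω (if_neg (by simp)))
        (fun v => keyBits_xorShift_of_eq_false hm c φ κ₀ ω (if_neg (by simp))) i]
    rw [pipeline_e _ _ _ _ _ _ ht, pipeline_e _ _ _ _ _ _ ht, hd, messageBits_xorShift,
      hz ω (v := .B i) (if_neg (by simp)), keyBits_xorShift, if_pos rfl, stream_xor, stream_xor]
    generalize stream m (messageBits hm c φ κ₀ ω i) (t - 3 * m) = x
    generalize stream m (keyBits hm c φ κ₀ ω (.F i) i) (t - 3 * m) = y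
    generalize stream m (δ i) (t - 3 * m) = z
    cases x <;> cases y <;> cases z <;> simp

/-- Each block of the keys `κⱼ` is uniform. -/
theorem sum_weight_mul_block (l : Fin L) (f : (Fin K → Fin k → Bool) → ℝ) :
    ∑ ω, (pipeline hm L k n c φ κ₀).weight ω *
      f (fun j => keyBits hm c φ κ₀ ω (.B j) j l) =
      ∑ u, (Fintype.card (Fin K → Fin k → Bool) : ℝ)⁻¹ * f u := by
  set S := ∑ ω, (pipeline hm L k n c φ κ₀).weight ω *
      f (fun j => keyBits hm c φ κ₀ ω (.B j) j l) with hS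
  have h1 : ∀ δ : Fin K → Fin k → Bool, S = ∑ ω, (pipeline hm L k n c φ κ₀).weight ω *
      f (fun j q => xor (keyBits hm c φ κ₀ ω (.B j) j l q) (δ j q)) := by
    intro δ
    rw [hS, ← Equiv.sum_comp (xorShift_involutive hm c φ κ₀ (fun _ _ _ => false)
      fun _ i _ q => δ i q).toPerm]
    refine Finset.sum_congr rfl fun ω _ => ?_
    simp only [Function.Involutive.coe_toPerm, keyBits_xorShift]
    rfl
  have h2 : ∀ u : Fin K → Fin k → Bool, ∑ δ : Fin K → Fin k → Bool,
      f (fun j q => xor (u j q) (δ j q)) = ∑ u, f u := by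
    intro u
    have hinv : Function.Involutive fun δ : Fin K → Fin k → Bool =>
      fun j q => xor (u j q) (δ j q) := fun δ => by simp
    exact Equiv.sum_comp hinv.toPerm f
  have h3 : (Fintype.card (Fin K → Fin k → Bool) : ℝ) * S = ∑ u, f u := by
    rw [← nsmul_eq_mul, ← Finset.card_univ, ← Finset.sum_const,
      Finset.sum_congr rfl fun δ _ => h1 δ, Finset.sum_comm]
    simp_rw [← Finset.mul_sum, h2]
    rw [← Finset.sum_mul, Code.sum_weight, one_mul]
  rw [← Finset.mul_sum, ← h3, inv_mul_cancel_left₀]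
  exact_mod_cast Fintype.card_ne_zero

open Classical in
theorem pipeline_errorProb_le (hkm : k ≤ m) (hφ : ∀ i, Function.Injective (φ i))
    (hn : (L + 3) * m ≤ n) :
    (pipeline hm L k n c φ κ₀).errorProb () ≤ L * ∑ i, ∑ u : Fin K → Fin k → Bool,
      (Fintype.card (Fin K → Fin k → Bool) : ℝ)⁻¹ *
        (if c.output (fun j => φ j (u j), κ₀) i ≠ φ i (u i) then 1 else 0) := by
  let f : Fin K → (Fin K → Fin k → Bool) → ℝ := fun i u =>
    if c.output (fun j => φ j (u j), κ₀) i ≠ φ i (u i) then 1 else 0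
  have hf : ∀ i u, 0 ≤ f i u := fun i u => by positivity
  have h1 : (pipeline hm L k n c φ κ₀).errorProb () ≤
      ∑ ω, (pipeline hm L k n c φ κ₀).weight ω *
        ∑ l : Fin L, ∑ i, f i fun j => keyBits hm c φ κ₀ ω (.B j) j l := by
    refine Finset.sum_le_sum fun ω _ => ?_
    have hw := (pipeline hm L k n c φ κ₀).weight_nonneg ω
    split_ifs with h
    · refine le_mul_of_one_le_right hw ?_
      by_contra hlt
      refine h (pipeline_output hm c φ κ₀ ω hkm hφ hn fun l i => ?_)
      by_contra hne
      refine hlt ?_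
      have h2 : f i (fun j => keyBits hm c φ κ₀ ω (.B j) j l) = 1 := if_pos hne
      rw [← h2]
      exact (Finset.single_le_sum
        (f := fun i => f i fun j => keyBits hm c φ κ₀ ω (.B j) j l)
        (fun i _ => hf _ _) (Finset.mem_univ i)).trans (Finset.single_le_sum
        (f := fun l => ∑ i, f i fun j => keyBits hm c φ κ₀ ω (.B j) j l)
        (fun l _ => Finset.sum_nonneg fun i _ => hf _ _) (Finset.mem_univ l))
    · exact mul_nonneg hw (Finset.sum_nonneg fun l _ => Finset.sum_nonneg fun i _ => hf _ _)
  refine h1.trans_eq ?_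
  simp_rw [Finset.mul_sum]
  rw [Finset.sum_comm]
  have h2 : ∀ l : Fin L, ∑ ω, ∑ i, (pipeline hm L k n c φ κ₀).weight ω *
      f i (fun j => keyBits hm c φ κ₀ ω (.B j) j l) =
      ∑ i, ∑ u, (Fintype.card (Fin K → Fin k → Bool) : ℝ)⁻¹ * f i u := by
    intro l
    rw [Finset.sum_comm]
    exact Finset.sum_congr rfl fun i _ => sum_weight_mul_block hm c φ κ₀ l (f i)
  simp_rw [h2]
  simp [f, Finset.mul_sum]

end Secrecy

/-! ### The secrecy capacity -/

section Capacity

variable {V E : Type*} [Fintype V] [DecidableEq V] [DecidableEq E] {K : ℕ}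
  {N : CommProblem V E (Fin K)}

/-- Perfect secrecy is required at every length, also where the pipelined code is not used. -/
theorem exists_code_leakage_eq_zero (n : ℕ) :
    Nonempty {c : Code (secureUnicast N) n // ∀ e, c.leakage {e} = 0} := by
  let c : Code (secureUnicast N) n :=
    { msgCard := fun _ => 1
      msgCard_pos := fun _ => one_pos
      keyCard := fun _ => 1
      keyProb := fun _ _ => 1
      keyProb_nonneg := fun _ _ => zero_le_one
      keyProb_sum := fun _ => by simp
      encode := fun _ _ _ _ _ => false
      decode := fun _ _ _ _ => 0 }
  have : Subsingleton c.Msg := inferInstanceAs (Subsingleton (Unit → Fin 1))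
  exact ⟨c, fun e => c.leakage_eq_zero e fun m m' =>
    ⟨Equiv.refl _, fun _ => rfl, fun ω => by simp [eq_iff_true_of_subsingleton], fun _ => rfl⟩⟩

/-- If the unicast problem is feasible, the pipelined codes achieve the rate `K` without leakage. -/
theorem secrecyFeasible_of_feasible (h : N.Feasible fun _ => 1) (σ : Secrecy) :
    (secureUnicast N).SecrecyFeasible (singleLinks (SecureLink E K)) σ K := by
  have hne := exists_code_leakage_eq_zero (N := N)
  suffices hev : ∀ η > 0, ∀ᶠ n in Filter.atTop,
      ∃ c : {c : Code (secureUnicast N) n // ∀ e, c.leakage {e} = 0},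
        |c.1.rate () - K| + c.1.errorProb () ≤ η by
    obtain ⟨c, hc⟩ := exists_seq_tendsto_zero
      (C := fun n => {c : Code (secureUnicast N) n // ∀ e, c.leakage {e} = 0})
      (fun n c => |c.1.rate () - K| + c.1.errorProb ())
      (fun n c => add_nonneg (abs_nonneg _) (c.1.errorProb_nonneg ())) hev
    refine ⟨fun n => (c n).1, fun _ => ⟨?_, ?_⟩, ?_⟩
    · rw [tendsto_iff_dist_tendsto_zero]
      exact squeeze_zero (fun _ => dist_nonneg)
        (fun n => le_add_of_nonneg_right ((c n).1.errorProb_nonneg ())) hc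
    · exact squeeze_zero (fun n => (c n).1.errorProb_nonneg ())
        (fun n => le_add_of_nonneg_left (abs_nonneg _)) hc
    · rintro A ⟨e, rfl⟩
      have h0 : (fun n => (c n).1.leakage {e}) = fun _ => 0 := funext fun n => (c n).2 e
      rw [h0]
      cases σ with
      | perfect => exact fun _ => rfl
      | strong => exact tendsto_const_nhds
      | weak => simp [Secrecy.Holds]
  intro η hη
  obtain ⟨c₀, hc₀⟩ := h
  obtain ⟨ε, hε, hε1, hεη⟩ : ∃ ε : ℝ, 0 < ε ∧ ε ≤ 1 ∧ K * (3 * ε) + ε ≤ η := by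
    refine ⟨min 1 (η / (3 * K + 1)), by positivity, min_le_left _ _, ?_⟩
    have h1 : min 1 (η / (3 * K + 1)) ≤ η / (3 * K + 1) := min_le_right _ _
    rw [le_div_iff₀ (by positivity)] at h1
    linarith
  -- with `L` blocks, the three idle periods cost a fraction of at most `ε` of the slots
  set L : ℕ := ⌈3 / ε⌉₊
  have hL : 3 / ε ≤ L := Nat.le_ceil _
  have hL0 : (0 : ℝ) < L := lt_of_lt_of_le (by positivity) hL
  rw [div_le_iff₀ hε] at hL
  have e1 : ∀ᶠ m in Filter.atTop, ∀ i, 1 - ε < (c₀ m).rate i :=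
    Filter.eventually_all.2 fun i => (hc₀ i).1.eventually (lt_mem_nhds (by linarith))
  have e2 : ∀ᶠ m in Filter.atTop, ∑ i, (c₀ m).errorProb i < ε / L := by
    have h1 : Filter.Tendsto (fun m => ∑ i, (c₀ m).errorProb i) Filter.atTop (nhds 0) := by
      simpa using tendsto_finsetSum Finset.univ fun i _ => (hc₀ i).2
    exact h1.eventually (gt_mem_nhds (by positivity))
  have hdiv : Filter.Tendsto (fun n => n / (L + 3)) Filter.atTop Filter.atTop :=
    (Filter.map_div_atTop_eq_nat (L + 3) (by omega)).le
  have e3 : ∀ᶠ n : ℕ in Filter.atTop, (2 * L + 3) / ε ≤ (n : ℝ) :=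
    tendsto_natCast_atTop_atTop.eventually_ge_atTop _
  filter_upwards [hdiv.eventually (e1.and (e2.and (Filter.eventually_gt_atTop 0))), e3]
    with n ⟨h1, h2, hm⟩ h3
  set m := n / (L + 3)
  set k : ℕ := ⌊m * (1 - ε)⌋₊
  have hmε : 0 ≤ m * (1 - ε) := mul_nonneg (Nat.cast_nonneg _) (by linarith)
  have hk1 : (k : ℝ) ≤ m * (1 - ε) := Nat.floor_le hmε
  have hk2 : m * (1 - ε) < k + 1 := Nat.lt_floor_add_one _
  have hm0 : (0 : ℝ) < m := by exact_mod_cast hm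
  have hkm : k ≤ m := by
    have : (k : ℝ) ≤ m := hk1.trans (mul_le_of_le_one_right hm0.le (by linarith))
    exact_mod_cast this
  have hn : (L + 3) * m ≤ n := Nat.mul_div_le n (L + 3)
  have hn' : n < (L + 3) * (m + 1) := Nat.lt_mul_div_succ n (by omega)
  have hlog : (0 : ℝ) < Real.log 2 := Real.log_pos one_lt_two
  have hcard : ∀ i, 2 ^ k ≤ (c₀ m).msgCard i := by
    intro i
    have hpos : (0 : ℝ) < (c₀ m).msgCard i := by exact_mod_cast (c₀ m).msgCard_pos i
    have h4 : Real.log ((2 : ℝ) ^ k) ≤ Real.log ((c₀ m).msgCard i) := by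
      rw [(c₀ m).log_msgCard_eq i hm, Real.log_pow, ← mul_assoc]
      refine mul_le_mul_of_nonneg_right (hk1.trans ?_) hlog.le
      rw [mul_comm]
      exact mul_le_mul_of_nonneg_right (h1 i).le hm0.le
    exact_mod_cast (Real.log_le_log_iff (by positivity) hpos).1 h4
  obtain ⟨φ, κ₀, hφ, herr⟩ := (c₀ m).exists_restriction hcard
  refine ⟨⟨pipeline hm L k n (c₀ m) φ κ₀, pipeline_leakage hm (c₀ m) φ κ₀⟩, ?_⟩
  have hE : (pipeline hm L k n (c₀ m) φ κ₀).errorProb () ≤ ε := by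
    refine (pipeline_errorProb_le hm (c₀ m) φ κ₀ hkm hφ hn).trans ?_
    rw [lt_div_iff₀ hL0] at h2
    have := mul_le_mul_of_nonneg_left herr hL0.le
    linarith
  have hR : |(pipeline hm L k n (c₀ m) φ κ₀).rate () - K| ≤ K * (3 * ε) := by
    have hn0 : (0 : ℝ) < n := by
      have : 0 < n := lt_of_lt_of_le (Nat.mul_pos (by omega) hm) hn
      exact_mod_cast this
    rw [Code.rate_eq_of_msgCard _ (k := K * (L * k)) rfl]
    have hnR : ((L : ℝ) + 3) * m ≤ n := by exact_mod_cast hn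
    have hnR' : (n : ℝ) < (L + 3) * (m + 1) := by exact_mod_cast hn'
    have hkmR : (k : ℝ) ≤ m := by exact_mod_cast hkm
    have hLk : (L : ℝ) * k ≤ L * m := mul_le_mul_of_nonneg_left hkmR hL0.le
    have hub : (L : ℝ) * k ≤ n := by linarith
    rw [div_le_iff₀ hε] at h3
    have hlb : n * (1 - 3 * ε) ≤ (L : ℝ) * k := by
      have h5 : (L : ℝ) * (m * (1 - ε)) ≤ L * (k + 1) := mul_le_mul_of_nonneg_left hk2.le hL0.le
      have h6 : (L : ℝ) * m * ε ≤ n * ε := mul_le_mul_of_nonneg_right (by linarith) hε.le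
      have h7 : 3 * (m : ℝ) ≤ n * ε := by
        have := mul_le_mul_of_nonneg_right hnR hε.le
        have := mul_le_mul_of_nonneg_right hL hm0.le
        have : 0 ≤ 3 * m * ε := by positivity
        linarith
      linarith
    have h8 : (((K * (L * k) : ℕ) : ℝ) / n - K) = K * ((L * k) / n - 1) := by
      push_cast
      ring
    rw [h8, abs_mul, Nat.abs_cast]
    refine mul_le_mul_of_nonneg_left ?_ (Nat.cast_nonneg K)
    have h9 : (L : ℝ) * k / n ≤ 1 := (div_le_one hn0).2 hub
    have h10 : 1 - 3 * ε ≤ (L : ℝ) * k / n := by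
      rw [le_div_iff₀ hn0]
      linarith
    rw [abs_le]
    constructor <;> linarith
  dsimp only
  linarith

end Capacity

theorem theorem1 {V E : Type*} [Fintype V] [DecidableEq V] [Fintype E] [DecidableEq E]
    (K : ℕ) (N : CommProblem V E (Fin K)) (σ : Secrecy) :
    (secureUnicast N).IsSecrecyCapacity (singleLinks (SecureLink E K)) σ (K : ℝ) ↔
      N.Feasible (fun _ => 1) := by
  constructor
  · intro h
    refine feasible_of_secrecyFeasible (σ := σ) fun δ hδ => ?_
    obtain ⟨R, hR, hlt, -⟩ := h.exists_between (show (K : ℝ) - δ < K by linarith)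
    exact ⟨R, hlt, hR⟩
  · intro h
    refine ⟨fun R hR => ?_, fun b hb => hb (secrecyFeasible_of_feasible h σ)⟩
    obtain ⟨c, hc, -⟩ := hR
    exact rate_le_of_communicates hc
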